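/- Let $k$ be an algebraically closed field of characteristic $0$, let $M$ be a free $\mathbb Z$-module of finite rank, and let $\Delta$ be a fan in $M^*_{\mathbb Q}=\operatorname{Hom}_{\mathbb Z}(M,\mathbb Q)$, i.e. a nonempty finite set of strongly convex rational polyhedral cones, closed under taking faces, any two of which meet in a common face. Let $X=\bigcup_{\sigma\in\Delta}U_\sigma$, with $U_\sigma=\operatorname{Spec}k[S_\sigma]$ and $S_\sigma=\{\alpha\in M: v(\alpha)\ge 0\ \text{for all } v\in\sigma\}$, be the toric variety of $\Delta$, with torus $T_M=\operatorname{Spec}k[M]$, and assume that $X$ is complete. For a point $\lambda\in T_M$, i.e. a group morphism $\lambda:M\to k^\times$, let $h_\lambda:X\to X$ be the action of $\lambda$, given by $x^\alpha\mapsto\lambda(\alpha)x^\alpha$. Let $\operatorname{Aut}_{to}X$ be the group of toric automorphisms of $X$: the pairs $(f,\phi)$ of an automorphism $f$ of the $k$-scheme $X$ and an automorphism $\phi$ of the algebraic group $T_M$ such that $f\circ h_\lambda=h_{\phi(\lambda)}\circ f$ for all $\lambda\in T_M$. The (points of the) torus $T_M$ form a normal subgroup of $\operatorname{Aut}_{to}X$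 through $\lambda\mapsto(h_\lambda,\mathrm{id})$. Let $\operatorname{Aut}_\Delta M$ be the group of automorphisms $\tau$ of $M$ such that $\tau^*(\sigma)\in\Delta$ for every $\sigma\in\Delta$, where $\tau^*(v)=v\circ\tau$. Each $\tau\in\operatorname{Aut}_\Delta M$ induces a toric automorphism $f_\tau:X\to X$, given by $x^\alpha\mapsto x^{\tau(\alpha)}$ and accompanied by the automorphism of $T_M$ given by the same formula, and $f_{\tau\circ\tau'}=f_{\tau'}\circ f_\tau$. Then the natural morphism $$\operatorname{Aut}_\Delta M\longrightarrow \operatorname{Aut}_{to}X/T_M,\qquad \tau\longmapsto [f_\tau],$$ is an isomorphism of groups, where $\operatorname{Aut}_\Delta M$ carries the opposite of the composition law (equivalently, $\tau\mapsto[f_{\tau^{-1}}]$ is an isomorphism for the usual composition law). -/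

import Mathlib

universe u

noncomputable section

open CategoryTheory Limits AlgebraicGeometry Opposite

namespace Toric

/-- The rational dual space `M^* ⊗ ℚ` of a lattice `M` (free of finite rank), in the form
`Hom_ℤ(M, ℚ)`. -/
abbrev DualQ (M : Type u) [AddCommGroup M] : Type u := M →ₗ[ℤ] ℚ

section Fans

variable {M : Type u} [AddCommGroup M]

/-- `τ` is a face of the rational polyhedral cone `σ`: it is cut out in `σ` by a supporting
hyperplane `m^⊥`, where `m` is nonnegative on `σ`. The cones are rational, so `m` may be taken
in the lattice `M`. -/
def IsFace (τ σ : PointedCone ℚ (DualQ M)) : Prop :=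
  ∃ m : M, (∀ v ∈ σ, 0 ≤ v m) ∧ ∀ v, v ∈ τ ↔ v ∈ σ ∧ v m = 0

variable (M) in
/-- A fan in `M^* ⊗ ℚ`: a finite nonempty set of strongly convex polyhedral (that is, finitely
generated) rational cones, closed under faces, such that two of its cones meet in a face of each. -/
structure Fan where
  cones : Set (PointedCone ℚ (DualQ M))
  finite : cones.Finite
  nonempty : cones.Nonempty
  fg : ∀ σ ∈ cones, σ.FG
  pointed : ∀ σ ∈ cones, ∀ v ∈ σ, -v ∈ σ → v = 0
  face_mem : ∀ σ ∈ cones, ∀ τ, IsFace τ σ → τ ∈ cones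
  inter_face : ∀ σ ∈ cones, ∀ τ ∈ cones, IsFace (σ ⊓ τ) σ

/-- The monoid `S_σ = σ^∨ ∩ M` of lattice points that are nonnegative on `σ`. -/
def dualMonoid (σ : PointedCone ℚ (DualQ M)) : AddSubmonoid M where
  carrier := {m | ∀ v ∈ σ, 0 ≤ v m}
  zero_mem' := by intro v _; simp
  add_mem' := by
    intro a b ha hb v hv
    rw [map_add]
    exact add_nonneg (ha v hv) (hb v hv)

/-- The transpose `τ^* : M^* ⊗ ℚ → M^* ⊗ ℚ`, `v ↦ v ∘ τ`, of a lattice automorphism `τ`. -/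
def transpose (τ : M ≃ₗ[ℤ] M) : DualQ M →ₗ[ℚ] DualQ M where
  toFun v := v ∘ₗ τ.toLinearMap
  map_add' _ _ := rfl
  map_smul' _ _ := rfl

@[simp] lemma transpose_apply (τ : M ≃ₗ[ℤ] M) (v : DualQ M) (m : M) :
    transpose τ v m = v (τ m) := rfl

lemma transpose_mul (τ τ' : M ≃ₗ[ℤ] M) (σ : PointedCone ℚ (DualQ M)) :
    PointedCone.map (transpose (τ * τ')) σ =
      PointedCone.map (transpose τ') (PointedCone.map (transpose τ) σ) := by
  rw [PointedCone.map_map]; rfl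

lemma transpose_one (σ : PointedCone ℚ (DualQ M)) :
    PointedCone.map (transpose (1 : M ≃ₗ[ℤ] M)) σ = σ := by
  have : transpose (1 : M ≃ₗ[ℤ] M) = LinearMap.id := rfl
  rw [this, PointedCone.map_id]

/-- `Aut_Δ M`: the group (under composition) of lattice automorphisms `τ` of `M` such that
`τ^*(σ) ∈ Δ` for every cone `σ ∈ Δ`. -/
def autFan (Δ : Fan M) : Subgroup (M ≃ₗ[ℤ] M) where
  carrier := {τ | ∀ σ ∈ Δ.cones, PointedCone.map (transpose τ) σ ∈ Δ.cones}
  one_mem' := by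
    intro σ hσ
    rwa [transpose_one]
  mul_mem' := by
    intro a b ha hb σ hσ
    rw [transpose_mul]
    exact hb _ (ha _ hσ)
  inv_mem' := by
    intro a ha σ hσ
    have hinj : Set.InjOn (fun σ => PointedCone.map (transpose a) σ) Δ.cones := by
      intro x _ y _ hxy
      have := congrArg (PointedCone.map (transpose a⁻¹)) hxy
      simpa only [← transpose_mul, mul_inv_cancel, transpose_one] using this
    obtain ⟨ρ, hρ, h⟩ :=
      ((Set.Finite.injOn_iff_bijOn_of_mapsTo Δ.finite ha).1 hinj).surjOn hσ
    have h' : PointedCone.map (transpose a) ρ = σ := h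
    rw [← h', ← transpose_mul, mul_inv_cancel, transpose_one]
    exact hρ

end Fans

section Charts

variable (k : Type u) [Field k] {M : Type u} [AddCommGroup M]

/-- The monoid algebra `k[S_σ]`. -/
abbrev coordAlg (σ : PointedCone ℚ (DualQ M)) : Type u := AddMonoidAlgebra k (dualMonoid σ)

/-- The `k`-algebra morphism `k[S_σ] → k[S_σ']`, `x^m ↦ x^{φ(m)}`, given by an additive map `φ` of `M`
with `φ(S_σ) ⊆ S_σ'`. -/
def coordMap {σ σ' : PointedCone ℚ (DualQ M)} (φ : M →+ M)
    (h : ∀ m ∈ dualMonoid σ, φ m ∈ dualMonoid σ') : coordAlg k σ →ₐ[k] coordAlg k σ' :=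
  AddMonoidAlgebra.mapDomainAlgHom k k
    ((φ.comp (dualMonoid σ).subtype).codRestrict (dualMonoid σ') fun m => h m m.2)

@[simp] lemma coordMap_single {σ σ' : PointedCone ℚ (DualQ M)} (φ : M →+ M)
    (h : ∀ m ∈ dualMonoid σ, φ m ∈ dualMonoid σ') (m : dualMonoid σ) (c : k) :
    coordMap k φ h (AddMonoidAlgebra.single m c) =
      AddMonoidAlgebra.single ⟨φ m, h m m.2⟩ c := by
  simp [coordMap]
  rfl

lemma dualMonoid_anti {σ σ' : PointedCone ℚ (DualQ M)} (h : σ ≤ σ') :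
    ∀ m ∈ dualMonoid σ', AddMonoidHom.id M m ∈ dualMonoid σ :=
  fun _ hm v hv => hm v (h hv)

/-- The affine toric variety `U_σ = Spec k[S_σ]`, as a scheme over `k`. -/
abbrev chart (σ : PointedCone ℚ (DualQ M)) : Over (Spec (.of k)) :=
  (algSpec (.of k)).obj (op (CommAlgCat.of k (coordAlg k σ)))

/-- The morphism of `k`-schemes `U_σ' → U_σ` dual to a `k`-algebra morphism `k[S_σ] → k[S_σ']`. -/
def chartMap {σ σ' : PointedCone ℚ (DualQ M)} (f : coordAlg k σ →ₐ[k] coordAlg k σ') :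
    chart k σ' ⟶ chart k σ :=
  (algSpec (.of k)).map (CommAlgCat.ofHom f).op

lemma chartMap_comp {σ σ' σ'' : PointedCone ℚ (DualQ M)} (f : coordAlg k σ →ₐ[k] coordAlg k σ')
    (g : coordAlg k σ' →ₐ[k] coordAlg k σ'') :
    chartMap k (g.comp f) = chartMap k g ≫ chartMap k f := by
  rw [chartMap, CommAlgCat.ofHom_comp, op_comp, Functor.map_comp]; rfl

lemma chartMap_id (σ : PointedCone ℚ (DualQ M)) :
    chartMap k (AlgHom.id k (coordAlg k σ)) = 𝟙 _ := by
  rw [chartMap, CommAlgCat.ofHom_id, op_id, CategoryTheory.Functor.map_id]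

lemma coordMap_id (σ : PointedCone ℚ (DualQ M)) (h) :
    coordMap k (σ := σ) (σ' := σ) (AddMonoidHom.id M) h = AlgHom.id k _ := by
  ext; simp

lemma coordMap_comp {σ σ' σ'' : PointedCone ℚ (DualQ M)} (φ ψ : M →+ M) (h h' h'') :
    (coordMap k (σ := σ') (σ' := σ'') ψ h').comp (coordMap k (σ := σ) φ h) =
      coordMap k (ψ.comp φ) h'' := by
  ext; simp

variable (Δ : Fan M)

/-- The diagram of the affine toric varieties `U_σ`, `σ ∈ Δ`, and the inclusions `U_σ → U_τ` for
`σ ⊆ τ`. -/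
def chartDiagram : Δ.cones ⥤ Over (Spec (.of k)) where
  obj σ := chart k σ.1
  map f := chartMap k (coordMap k _ (dualMonoid_anti (leOfHom f)))
  map_id σ := by rw [coordMap_id, chartMap_id]
  map_comp f g := by
    rw [← chartMap_comp, coordMap_comp]; rfl

lemma IsFace.exists_nsmul {σ τ : PointedCone ℚ (DualQ M)} (hσ : σ.FG) {m : M}
    (hm : ∀ v ∈ σ, 0 ≤ v m) (hτ : ∀ v, v ∈ τ ↔ v ∈ σ ∧ v m = 0) (u : M)
    (hu : u ∈ dualMonoid τ) : ∃ N : ℕ, ∀ n ≥ N, u + n • m ∈ dualMonoid σ := by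
  obtain ⟨s, rfl⟩ := hσ
  have key : ∀ v ∈ s, ∃ N : ℕ, ∀ n ≥ N, 0 ≤ v (u + n • m) := by
    intro v hv
    have hvσ : v ∈ Submodule.span {c : ℚ // 0 ≤ c} (s : Set (DualQ M)) := Submodule.subset_span hv
    rcases (hm v hvσ).eq_or_lt with h0 | hpos
    · refine ⟨0, fun n _ => ?_⟩
      have := hu v ((hτ v).2 ⟨hvσ, h0.symm⟩)
      simpa [← h0] using this
    · obtain ⟨N, hN⟩ := exists_nat_ge (-(v u) / v m)
      refine ⟨N, fun n hn => ?_⟩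
      rw [div_le_iff₀ hpos] at hN
      have h2 : (N : ℚ) * v m ≤ n * v m := by gcongr
      rw [map_add, map_nsmul, nsmul_eq_mul]
      linarith
  choose! N hN using key
  refine ⟨s.sup N, fun n hn v hv => ?_⟩
  induction hv using Submodule.span_induction with
  | mem x hx => exact hN x hx n ((Finset.le_sup hx).trans hn)
  | zero => simp
  | add x y _ _ hx hy => exact add_nonneg hx hy
  | smul a x _ hx => exact mul_nonneg a.2 hx

lemma isLocalization_coordMap {σ τ : PointedCone ℚ (DualQ M)} (hσ : σ.FG) (hle : τ ≤ σ) {m : M}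
    (hm : ∀ v ∈ σ, 0 ≤ v m) (hτ : ∀ v, v ∈ τ ↔ v ∈ σ ∧ v m = 0) :
    letI := (coordMap k _ (dualMonoid_anti hle)).toRingHom.toAlgebra
    IsLocalization.Away (AddMonoidAlgebra.single (⟨m, hm⟩ : dualMonoid σ) (1 : k))
      (coordAlg k τ) := by
  let _ := (coordMap k _ (dualMonoid_anti hle)).toRingHom.toAlgebra
  have hmap : ∀ x, algebraMap (coordAlg k σ) (coordAlg k τ) x =
      coordMap k _ (dualMonoid_anti hle) x := fun _ => rfl
  have hneg : -m ∈ dualMonoid τ := fun v hv => by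
    rw [map_neg, ((hτ v).1 hv).2, neg_zero]
  refine ⟨⟨?_, ?_, ?_⟩⟩
  · rintro ⟨_, n, rfl⟩
    rw [hmap]
    dsimp only
    rw [map_pow, coordMap_single]
    refine IsUnit.pow _ (IsUnit.of_mul_eq_one (AddMonoidAlgebra.single ⟨-m, hneg⟩ 1) ?_)
    rw [AddMonoidAlgebra.single_mul_single, AddMonoidAlgebra.one_def]
    congr 1
    · ext; simp
    · simp
  · intro z
    suffices h : ∃ N : ℕ, ∀ n ≥ N, ∃ x : coordAlg k σ,
        z * algebraMap _ _ ((AddMonoidAlgebra.single (⟨m, hm⟩ : dualMonoid σ) (1 : k)) ^ n) =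
          algebraMap _ _ x by
      obtain ⟨N, hN⟩ := h
      obtain ⟨x, hx⟩ := hN N le_rfl
      exact ⟨⟨x, ⟨_, N, rfl⟩⟩, hx⟩
    induction z using AddMonoidAlgebra.induction_linear with
    | zero => exact ⟨0, fun n _ => ⟨0, by simp⟩⟩
    | add f g hf hg =>
      obtain ⟨N, hN⟩ := hf
      obtain ⟨N', hN'⟩ := hg
      refine ⟨max N N', fun n hn => ?_⟩
      obtain ⟨x, hx⟩ := hN n ((le_max_left _ _).trans hn)
      obtain ⟨y, hy⟩ := hN' n ((le_max_right _ _).trans hn)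
      exact ⟨x + y, by rw [add_mul, hx, hy, map_add]⟩
    | single u c =>
      obtain ⟨N, hN⟩ := IsFace.exists_nsmul hσ hm hτ u u.2
      refine ⟨N, fun n hn => ⟨AddMonoidAlgebra.single ⟨_, hN n hn⟩ c, ?_⟩⟩
      rw [hmap, hmap, AddMonoidAlgebra.single_pow, coordMap_single, coordMap_single,
        AddMonoidAlgebra.single_mul_single]
      congr 1
      simp
  · intro x y hxy
    refine ⟨1, ?_⟩
    congr 1
    rw [hmap, hmap] at hxy
    refine AddMonoidAlgebra.mapDomain_injective ?_ hxy
    intro a b hab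
    have h := congrArg (fun z : dualMonoid τ => (z : M)) hab
    exact Subtype.ext h

lemma chartMap_face_isOpenImmersion {σ τ : PointedCone ℚ (DualQ M)} (hσ : σ.FG) (hle : τ ≤ σ)
    (h : IsFace τ σ) : IsOpenImmersion (chartMap k (coordMap k _ (dualMonoid_anti hle))).left := by
  obtain ⟨m, hm, hτ⟩ := h
  let _ := (coordMap k _ (dualMonoid_anti hle)).toRingHom.toAlgebra
  have := isLocalization_coordMap k hσ hle hm hτ
  exact IsOpenImmersion.of_isLocalization
    (AddMonoidAlgebra.single (⟨m, hm⟩ : dualMonoid σ) (1 : k))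

lemma range_chartMap_face {σ τ : PointedCone ℚ (DualQ M)} (hσ : σ.FG) (hle : τ ≤ σ) {m : M}
    (hm : ∀ v ∈ σ, 0 ≤ v m) (hτ : ∀ v, v ∈ τ ↔ v ∈ σ ∧ v m = 0) :
    Set.range (chartMap k (coordMap k _ (dualMonoid_anti hle))).left =
      (PrimeSpectrum.basicOpen (AddMonoidAlgebra.single (⟨m, hm⟩ : dualMonoid σ) (1 : k)) :
        Set (PrimeSpectrum (coordAlg k σ))) := by
  let _ := (coordMap k _ (dualMonoid_anti hle)).toRingHom.toAlgebra
  have := isLocalization_coordMap k hσ hle hm hτ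
  exact PrimeSpectrum.localization_away_comap_range (coordAlg k τ)
    (AddMonoidAlgebra.single (⟨m, hm⟩ : dualMonoid σ) (1 : k))

lemma Fan.isFace_of_le {σ τ : Δ.cones} (h : τ ≤ σ) : IsFace τ.1 σ.1 := by
  have := Δ.inter_face σ σ.2 τ τ.2
  rwa [inf_eq_right.2 h] at this

instance chartDiagram_isOpenImmersion {σ τ : Δ.cones} (f : σ ⟶ τ) : IsOpenImmersion ((chartDiagram k Δ).map f).left :=
  chartMap_face_isOpenImmersion k (Δ.fg _ τ.2) (leOfHom f) (Δ.isFace_of_le (leOfHom f))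

instance chartDiagram_isLocallyDirected :
    (chartDiagram k Δ ⋙ Over.forget _ ⋙ Scheme.forget).IsLocallyDirected where
  cond := by
    intro σ₁ σ₂ σ f₁ f₂ x₁ x₂ hx
    obtain ⟨m₁, hm₁, h₁⟩ := Δ.isFace_of_le (leOfHom f₁)
    obtain ⟨m₂, hm₂, h₂⟩ := Δ.isFace_of_le (leOfHom f₂)
    let ρ : Δ.cones := ⟨σ₁.1 ⊓ σ₂.1, Δ.face_mem _ σ₁.2 _ (Δ.inter_face _ σ₁.2 _ σ₂.2)⟩
    have hρ₁ : ρ ≤ σ₁ := inf_le_left (a := σ₁.1) (b := σ₂.1)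
    have hρ₂ : ρ ≤ σ₂ := inf_le_right (a := σ₁.1) (b := σ₂.1)
    have hm : ∀ v ∈ σ.1, 0 ≤ v (m₁ + m₂) := fun v hv => by
      rw [map_add]; exact add_nonneg (hm₁ v hv) (hm₂ v hv)
    have hρ : ∀ v, v ∈ ρ.1 ↔ v ∈ σ.1 ∧ v (m₁ + m₂) = 0 := by
      intro v
      rw [show v ∈ ρ.1 ↔ v ∈ σ₁.1 ∧ v ∈ σ₂.1 from Iff.rfl, h₁, h₂, map_add]
      constructor
      · rintro ⟨⟨h, h3⟩, -, h4⟩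
        exact ⟨h, by rw [h3, h4, add_zero]⟩
      · rintro ⟨h, h3⟩
        have := hm₁ v h
        have := hm₂ v h
        exact ⟨⟨h, by linarith⟩, h, by linarith⟩
    have r₁ := range_chartMap_face k (Δ.fg _ σ.2) (leOfHom f₁) hm₁ h₁
    have r₂ := range_chartMap_face k (Δ.fg _ σ.2) (leOfHom f₂) hm₂ h₂
    have r := range_chartMap_face k (Δ.fg _ σ.2) (hρ₁.trans (leOfHom f₁)) hm hρ
    replace hx : ((chartDiagram k Δ).map f₁).left x₁ = ((chartDiagram k Δ).map f₂).left x₂ := hx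
    have hy : ((chartDiagram k Δ).map f₁).left x₁ ∈
        Set.range ((chartDiagram k Δ).map (homOfLE hρ₁ ≫ f₁)).left := by
      have hx₁ : ((chartDiagram k Δ).map f₁).left x₁ ∈
        Set.range ((chartDiagram k Δ).map f₁).left := ⟨x₁, rfl⟩
      have hx₂ : ((chartDiagram k Δ).map f₁).left x₁ ∈
        Set.range ((chartDiagram k Δ).map f₂).left := ⟨x₂, hx.symm⟩
      have hm' : (AddMonoidAlgebra.single (⟨m₁ + m₂, hm⟩ : dualMonoid σ.1) (1 : k)) =
          AddMonoidAlgebra.single (⟨m₁, hm₁⟩ : dualMonoid σ.1) (1 : k) *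
            AddMonoidAlgebra.single (⟨m₂, hm₂⟩ : dualMonoid σ.1) (1 : k) := by
        rw [AddMonoidAlgebra.single_mul_single, mul_one]; rfl
      have hr : Set.range ((chartDiagram k Δ).map (homOfLE hρ₁ ≫ f₁)).left =
          Set.range ((chartDiagram k Δ).map f₁).left ∩
            Set.range ((chartDiagram k Δ).map f₂).left := by
        refine r.trans ?_
        rw [hm', PrimeSpectrum.basicOpen_mul]
        exact congrArg₂ (· ∩ ·) r₁.symm r₂.symm
      rw [hr]
      exact ⟨hx₁, hx₂⟩
    obtain ⟨y, hy⟩ := hy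
    refine ⟨ρ, homOfLE hρ₁, homOfLE hρ₂, y, ?_, ?_⟩
    · apply ((chartDiagram k Δ).map f₁).left.isOpenEmbedding.injective
      rw [← hy, Functor.map_comp]
      rfl
    · apply ((chartDiagram k Δ).map f₂).left.isOpenEmbedding.injective
      rw [← hx, ← hy, Subsingleton.elim (homOfLE hρ₁ ≫ f₁) (homOfLE hρ₂ ≫ f₂), Functor.map_comp]
      rfl

/-- The toric variety `X` of the fan `Δ`, as a scheme over `k`: the affine toric varieties `U_σ`
glued along the open immersions `U_(σ ⊓ τ) → U_σ` and `U_(σ ⊓ τ) → U_τ`. -/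
def toricVariety : Over (Spec (.of k)) := colimit (chartDiagram k Δ)

/-- The inclusion `U_σ → X`. -/
def toricInclusion (σ : Δ.cones) : chart k σ.1 ⟶ toricVariety k Δ :=
  colimit.ι (chartDiagram k Δ) σ

lemma toricInclusion_w {σ τ : Δ.cones} (h : σ.1 ≤ τ.1) :
    chartMap k (coordMap k _ (dualMonoid_anti h)) ≫ toricInclusion k Δ τ = toricInclusion k Δ σ :=
  colimit.w (chartDiagram k Δ) (homOfLE h)

lemma chartMap_toricInclusion_congr {σ : PointedCone ℚ (DualQ M)} {ρ ρ' : Δ.cones} (hρ : ρ.1 ≤ ρ'.1)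
    (φ φ' : M →+ M) (hφ : ∀ m, φ m = φ' m) (h : ∀ m ∈ dualMonoid ρ.1, φ m ∈ dualMonoid σ)
    (h' : ∀ m ∈ dualMonoid ρ'.1, φ' m ∈ dualMonoid σ) :
    chartMap k (coordMap k φ h) ≫ toricInclusion k Δ ρ =
      chartMap k (coordMap k φ' h') ≫ toricInclusion k Δ ρ' := by
  rw [← toricInclusion_w k Δ hρ, ← Category.assoc, ← chartMap_comp]
  congr 2
  ext m
  simp [hφ]

lemma toricVariety_hom_ext {Y : Over (Spec (.of k))} {f g : toricVariety k Δ ⟶ Y}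
    (h : ∀ σ, toricInclusion k Δ σ ≫ f = toricInclusion k Δ σ ≫ g) : f = g :=
  colimit.hom_ext h

end Charts

section Torus

variable (k : Type u) [Field k] (M : Type u) [AddCommGroup M]

/-- The torus `T_M = Spec k[M]`, as a group scheme over `k`. -/
abbrev torus : Grp (Over (Spec (.of k))) :=
  (hopfSpec (.of k)).obj (op (CommHopfAlgCat.of k (AddMonoidAlgebra k M)))

/-- The group `Hom(M, kˣ)` of `k`-points of the torus `T_M`. -/
abbrev torusPoints : Type u := Multiplicative M →* kˣ

variable {k M} in
lemma torusPoints_inv_mul (χ : torusPoints k M) : χ⁻¹ * χ = 1 := by ext; simp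

variable {k M} in
lemma torusPoints_mul_comm (χ χ' : torusPoints k M) : χ * χ' = χ' * χ := by
  ext; simp [mul_comm]

/-- `Spec k` as a scheme over `k`. -/
abbrev basePt : Over (Spec (.of k)) := (algSpec (.of k)).obj (op (CommAlgCat.of k k))

/-- The identification of the characters `χ : M → kˣ` with the morphisms of `k`-schemes
`Spec k → T_M`: `χ` corresponds to the point `x^m ↦ χ(m)`. -/
def torusPointEquiv : torusPoints k M ≃ (basePt k ⟶ (torus k M).X) where
  toFun χ := (algSpec (.of k)).map (CommAlgCat.ofHom
    (AddMonoidAlgebra.lift k k M ((Units.coeHom k).comp χ))).op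
  invFun p := ((AddMonoidAlgebra.lift k k M).symm
      ((algSpec.fullyFaithful (R := .of k)).preimage p).unop.hom).toHomUnits
  left_inv χ := by
    have h := (algSpec.fullyFaithful (R := .of k)).preimage_map (CommAlgCat.ofHom
      (AddMonoidAlgebra.lift k k M ((Units.coeHom k).comp χ))).op
    refine MonoidHom.ext fun m => Units.ext ?_
    refine (congrArg (fun g : op (CommAlgCat.of k k) ⟶ op (CommAlgCat.of k (AddMonoidAlgebra k M)) =>
      (AddMonoidAlgebra.lift k k M).symm (Quiver.Hom.unop g).hom m) h).trans ?_
    simp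
  right_inv p := by
    refine Eq.trans (congrArg _ ?_) ((algSpec.fullyFaithful (R := .of k)).map_preimage p)
    refine Quiver.Hom.unop_inj (CommAlgCat.hom_ext ?_)
    refine (Equiv.eq_symm_apply _).1 ?_
    ext m
    rfl

variable {k M}

lemma torusPointEquiv_comp (χ χ' : torusPoints k M) (f : AddMonoidAlgebra k M →ₐc[k] AddMonoidAlgebra k M)
    (h : ∀ m : M, AddMonoidAlgebra.lift k k M ((Units.coeHom k).comp χ)
      (f (AddMonoidAlgebra.single m 1)) = χ' (Multiplicative.ofAdd m)) :
    torusPointEquiv k M χ ≫ ((hopfSpec (.of k)).map (CommHopfAlgCat.ofHom f).op).hom.hom =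
      torusPointEquiv k M χ' := by
  have h2 : AddMonoidAlgebra.lift k k M ((Units.coeHom k).comp χ') =
      (AddMonoidAlgebra.lift k k M ((Units.coeHom k).comp χ)).comp (f : _ →ₐ[k] _) := by
    ext m
    simpa using (h m).symm
  change _ = (algSpec (.of k)).map (CommAlgCat.ofHom (AddMonoidAlgebra.lift k k M _)).op
  rw [h2, CommAlgCat.ofHom_comp, op_comp]
  exact ((algSpec (.of k)).map_comp _ _).symm

/-- The image `Φ(χ)` of a point `χ ∈ T_M` under an automorphism `Φ` of the group scheme `T_M`. -/
def torusAutPoints (Φ : Aut (torus k M)) (χ : torusPoints k M) : torusPoints k M :=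
  (torusPointEquiv k M).symm (torusPointEquiv k M χ ≫ Φ.hom.hom.hom)

lemma torusAutPoints_one (χ : torusPoints k M) : torusAutPoints 1 χ = χ := by
  rw [torusAutPoints, Equiv.symm_apply_eq]
  exact Category.comp_id _

lemma torusAutPoints_mul (Φ Ψ : Aut (torus k M)) (χ : torusPoints k M) :
    torusAutPoints (Φ * Ψ) χ = torusAutPoints Φ (torusAutPoints Ψ χ) := by
  rw [torusAutPoints, torusAutPoints, torusAutPoints, Equiv.apply_symm_apply, Category.assoc]
  rfl

/-- The automorphism of the group scheme `T_M` induced by a lattice automorphism `τ`, given on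
`k[M]` by `x^m ↦ x^{τ(m)}`. -/
def torusAutOfEquiv (τ : M ≃ₗ[ℤ] M) : Aut (torus k M) :=
  (hopfSpec (.of k)).mapIso
    (CommHopfAlgCat.isoMk (AddMonoidAlgebra.domCongrBialgEquiv k k τ.toAddEquiv)).op

lemma torusAutOfEquiv_points (τ : M ≃ₗ[ℤ] M) (χ : torusPoints k M) :
    torusAutPoints (torusAutOfEquiv τ) χ =
      χ.comp (AddMonoidHom.toMultiplicative τ.toAddEquiv.toAddMonoidHom) := by
  rw [torusAutPoints, Equiv.symm_apply_eq]
  refine torusPointEquiv_comp _ _ _ fun m => ?_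
  change AddMonoidAlgebra.lift k k M ((Units.coeHom k).comp χ)
    (AddMonoidAlgebra.domCongr k k τ.toAddEquiv (AddMonoidAlgebra.single m 1)) = _
  simp

lemma torusAutOfEquiv_one : torusAutOfEquiv (k := k) (1 : M ≃ₗ[ℤ] M) = 1 := by
  have : CommHopfAlgCat.isoMk (AddMonoidAlgebra.domCongrBialgEquiv k k
      (1 : M ≃ₗ[ℤ] M).toAddEquiv) = Iso.refl _ := by
    apply Iso.ext
    apply CommHopfAlgCat.hom_ext
    apply AddMonoidAlgebra.bialgHom_ext
    · intro m
      exact AddMonoidAlgebra.mapDomain_single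
    · exact Subsingleton.elim _ _
  rw [torusAutOfEquiv, this]
  exact (hopfSpec (.of k)).mapIso_refl _

lemma torusAutOfEquiv_mul (τ τ' : M ≃ₗ[ℤ] M) :
    torusAutOfEquiv (k := k) (τ * τ') = torusAutOfEquiv τ' * torusAutOfEquiv τ := by
  have : CommHopfAlgCat.isoMk (AddMonoidAlgebra.domCongrBialgEquiv k k (τ * τ').toAddEquiv) =
      CommHopfAlgCat.isoMk (AddMonoidAlgebra.domCongrBialgEquiv k k τ'.toAddEquiv) ≪≫
        CommHopfAlgCat.isoMk (AddMonoidAlgebra.domCongrBialgEquiv k k τ.toAddEquiv) := by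
    apply Iso.ext
    apply CommHopfAlgCat.hom_ext
    apply AddMonoidAlgebra.bialgHom_ext
    · intro m
      refine AddMonoidAlgebra.mapDomain_single.trans ?_
      have h : AddMonoidAlgebra.mapDomain τ (AddMonoidAlgebra.mapDomain τ'
          (AddMonoidAlgebra.single m (1 : k))) = AddMonoidAlgebra.single (τ (τ' m)) 1 := by
        rw [AddMonoidAlgebra.mapDomain_single, AddMonoidAlgebra.mapDomain_single]
      exact h.symm
    · exact Subsingleton.elim _ _
  rw [torusAutOfEquiv, this]
  exact (hopfSpec (.of k)).mapIso_trans
    (CommHopfAlgCat.isoMk (AddMonoidAlgebra.domCongrBialgEquiv k k τ.toAddEquiv)).op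
    (CommHopfAlgCat.isoMk (AddMonoidAlgebra.domCongrBialgEquiv k k τ'.toAddEquiv)).op

end Torus

section Automorphisms

variable (k : Type u) [Field k] {M : Type u} [AddCommGroup M] (Δ : Fan M)

/-- The automorphism `x^m ↦ χ(m) x^m` of `k[S_σ]` given by a point `χ` of the torus. -/
def actAlg (χ : torusPoints k M) (σ : PointedCone ℚ (DualQ M)) : coordAlg k σ →ₐ[k] coordAlg k σ :=
  AddMonoidAlgebra.lift k _ _
    { toFun := fun m => AddMonoidAlgebra.single m.toAdd (χ (.ofAdd (m.toAdd : M)) : k)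
      map_one' := by simp [AddMonoidAlgebra.one_def]
      map_mul' := fun a b => by simp [AddMonoidAlgebra.single_mul_single] }

@[simp] lemma actAlg_single (χ : torusPoints k M) (σ : PointedCone ℚ (DualQ M)) (m : dualMonoid σ)
    (c : k) : actAlg k χ σ (AddMonoidAlgebra.single m c) =
      AddMonoidAlgebra.single m (c * (χ (.ofAdd (m : M)) : k)) := by
  simp [actAlg]

/-- The morphism `h_χ : X → X`, multiplication by the point `χ ∈ T_M`, given on each `U_σ` by
`x^m ↦ χ(m) x^m`. -/
def actHom (χ : torusPoints k M) : toricVariety k Δ ⟶ toricVariety k Δ :=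
  colimMap
    { app := fun σ => chartMap k (actAlg k χ σ.1)
      naturality := fun σ τ f => by
        change chartMap k _ ≫ chartMap k _ = chartMap k _ ≫ chartMap k _
        rw [← chartMap_comp, ← chartMap_comp]
        congr 1
        ext m
        simp }

lemma toricInclusion_actHom (χ : torusPoints k M) (σ : Δ.cones) :
    toricInclusion k Δ σ ≫ actHom k Δ χ = chartMap k (actAlg k χ σ.1) ≫ toricInclusion k Δ σ :=
  ι_colimMap _ _

lemma actHom_one : actHom k Δ 1 = 𝟙 _ := by
  apply toricVariety_hom_ext
  intro σ
  rw [toricInclusion_actHom, show actAlg k 1 σ.1 = AlgHom.id k _ by ext; simp, chartMap_id,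
    Category.id_comp, Category.comp_id]

lemma actHom_mul (χ χ' : torusPoints k M) :
    actHom k Δ (χ * χ') = actHom k Δ χ' ≫ actHom k Δ χ := by
  apply toricVariety_hom_ext
  intro σ
  rw [toricInclusion_actHom, ← Category.assoc, toricInclusion_actHom, Category.assoc,
    toricInclusion_actHom, ← Category.assoc, ← chartMap_comp]
  congr 2
  ext m
  simp

/-- The action `χ ↦ h_χ` of the points of `T_M` on `X` by automorphisms of `k`-schemes. -/
def act : torusPoints k M →* Aut (toricVariety k Δ) where
  toFun χ :=
    { hom := actHom k Δ χ
      inv := actHom k Δ χ⁻¹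
      hom_inv_id := by rw [← actHom_mul, torusPoints_inv_mul, actHom_one]
      inv_hom_id := by
        rw [← actHom_mul, torusPoints_mul_comm, torusPoints_inv_mul, actHom_one] }
  map_one' := Iso.ext (actHom_one k Δ)
  map_mul' χ χ' := Iso.ext (actHom_mul k Δ χ χ')

/-- `Aut_to X`: the group of toric automorphisms of `X`, that is of pairs `(f, Φ)` of an automorphism
`f` of the `k`-scheme `X` and an automorphism `Φ` of the group scheme `T_M` such that
`f ∘ h_χ = h_{Φ(χ)} ∘ f` for every `χ ∈ T_M`. (The product in `Aut` is composition of maps.) -/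
def toricAut : Subgroup (Aut (toricVariety k Δ) × Aut (torus k M)) where
  carrier := {p | ∀ χ, p.1 * act k Δ χ = act k Δ (torusAutPoints p.2 χ) * p.1}
  one_mem' := by
    intro χ
    simp [torusAutPoints_one]
  mul_mem' := by
    intro p q hp hq χ
    rw [Prod.fst_mul, Prod.snd_mul, torusAutPoints_mul, mul_assoc, hq, ← mul_assoc, hp, mul_assoc]
  inv_mem' := by
    intro p hp χ
    have h := hp (torusAutPoints p.2⁻¹ χ)
    rw [← torusAutPoints_mul, mul_inv_cancel, torusAutPoints_one] at h
    rw [Prod.fst_inv, Prod.snd_inv, inv_mul_eq_iff_eq_mul, ← mul_assoc, h, mul_assoc,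
      mul_inv_cancel, mul_one]

/-- Every point `χ` of `T_M` is a toric automorphism `(h_χ, id)`. The range of this morphism is
`T_M` as a subgroup of `Aut_to X`. -/
def torusToToricAut : torusPoints k M →* toricAut k Δ where
  toFun χ := ⟨(act k Δ χ, 1), fun χ' => by
    rw [torusAutPoints_one, ← map_mul, ← map_mul, torusPoints_mul_comm]⟩
  map_one' := by ext1; simp
  map_mul' χ χ' := by ext1; simp

instance torusToToricAut_range_normal : (torusToToricAut k Δ).range.Normal where
  conj_mem := by
    rintro _ ⟨χ, rfl⟩ ⟨p, hp⟩
    refine ⟨torusAutPoints p.2 χ, ?_⟩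
    ext1
    refine Prod.ext ?_ ?_
    · change act k Δ _ = p.1 * act k Δ χ * p.1⁻¹
      rw [hp, mul_inv_cancel_right]
    · change 1 = p.2 * 1 * p.2⁻¹
      simp

variable {Δ}

/-- The cone `τ^*(σ)` of `Δ`, for `τ ∈ Aut_Δ M` and `σ ∈ Δ`. -/
def mapCone (τ : autFan Δ) (σ : Δ.cones) : Δ.cones :=
  ⟨PointedCone.map (transpose τ.1) σ.1, τ.2 σ.1 σ.2⟩

lemma mem_dualMonoid_of_mapCone (τ : autFan Δ) (σ : Δ.cones) :
    ∀ m ∈ dualMonoid (mapCone τ σ).1, τ.1.toAddEquiv.toAddMonoidHom m ∈ dualMonoid σ.1 :=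
  fun _ hm v hv => hm _ (PointedCone.mem_map.2 ⟨v, hv, rfl⟩)

/-- The morphism `U_σ → U_{τ^*(σ)}` given by `x^m ↦ x^{τ(m)}`. -/
def fanChartMap (τ : autFan Δ) (σ : Δ.cones) : chart k σ.1 ⟶ chart k (mapCone τ σ).1 :=
  chartMap k (coordMap k τ.1.toAddEquiv.toAddMonoidHom (mem_dualMonoid_of_mapCone τ σ))

/-- The morphism `f_τ : X → X` induced by `τ ∈ Aut_Δ M`, given by `x^m ↦ x^{τ(m)}`. -/
def fanHom (τ : autFan Δ) : toricVariety k Δ ⟶ toricVariety k Δ :=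
  colimit.desc (chartDiagram k Δ)
    { pt := toricVariety k Δ
      ι :=
        { app := fun σ => fanChartMap k τ σ ≫ toricInclusion k Δ (mapCone τ σ)
          naturality := fun σ σ' f => by
            have h := chartMap_toricInclusion_congr k Δ (σ := σ.1) (ρ := mapCone τ σ)
              (ρ' := mapCone τ σ') (Submodule.map_mono (leOfHom f))
              τ.1.toAddEquiv.toAddMonoidHom τ.1.toAddEquiv.toAddMonoidHom (fun _ => rfl)
              (mem_dualMonoid_of_mapCone τ σ)
              (fun m hm v hv => mem_dualMonoid_of_mapCone τ σ' m hm v (leOfHom f hv))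
            refine Eq.trans ?_ (h.symm.trans (Category.comp_id _).symm)
            refine (Category.assoc _ _ _).symm.trans (congrArg (· ≫ _) ?_)
            refine (chartMap_comp k _ _).symm.trans (congrArg _ ?_)
            ext m
            simp } }

lemma toricInclusion_fanHom (τ : autFan Δ) (σ : Δ.cones) :
    toricInclusion k Δ σ ≫ fanHom k τ = fanChartMap k τ σ ≫ toricInclusion k Δ (mapCone τ σ) :=
  colimit.ι_desc _ _

lemma fanHom_one : fanHom k (1 : autFan Δ) = 𝟙 _ := by
  apply toricVariety_hom_ext
  intro σ
  rw [toricInclusion_fanHom, Category.comp_id]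
  refine (chartMap_toricInclusion_congr k Δ (ρ := mapCone 1 σ) (ρ' := σ) (transpose_one σ.1).le _
    (AddMonoidHom.id M) (fun _ => rfl) (mem_dualMonoid_of_mapCone 1 σ) fun _ h => h).trans ?_
  rw [coordMap_id, chartMap_id, Category.id_comp]

lemma fanHom_mul (τ τ' : autFan Δ) : fanHom k (τ * τ') = fanHom k τ ≫ fanHom k τ' := by
  apply toricVariety_hom_ext
  intro σ
  rw [toricInclusion_fanHom, ← Category.assoc, toricInclusion_fanHom, Category.assoc,
    toricInclusion_fanHom, ← Category.assoc]
  refine (chartMap_toricInclusion_congr k Δ (ρ := mapCone (τ * τ') σ)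
    (ρ' := mapCone τ' (mapCone τ σ)) (transpose_mul τ.1 τ'.1 σ.1).le _
    (τ.1.toAddEquiv.toAddMonoidHom.comp τ'.1.toAddEquiv.toAddMonoidHom) (fun _ => rfl)
    (mem_dualMonoid_of_mapCone (τ * τ') σ) fun m hm => mem_dualMonoid_of_mapCone τ σ _
      (mem_dualMonoid_of_mapCone τ' (mapCone τ σ) m hm)).trans ?_
  rw [fanChartMap, fanChartMap, ← chartMap_comp, coordMap_comp]

/-- The automorphism `f_τ` of the `k`-scheme `X`. -/
def fanAut (τ : autFan Δ) : Aut (toricVariety k Δ) where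
  hom := fanHom k τ
  inv := fanHom k τ⁻¹
  hom_inv_id := by rw [← fanHom_mul, mul_inv_cancel, fanHom_one]
  inv_hom_id := by rw [← fanHom_mul, inv_mul_cancel, fanHom_one]

lemma fanAut_mem (τ : autFan Δ) : (fanAut k τ, torusAutOfEquiv τ.1) ∈ toricAut k Δ := by
  intro χ
  refine Iso.ext (toricVariety_hom_ext k Δ fun σ => ?_)
  change toricInclusion k Δ σ ≫ actHom k Δ χ ≫ fanHom k τ =
    toricInclusion k Δ σ ≫ fanHom k τ ≫ actHom k Δ _
  rw [torusAutOfEquiv_points, ← Category.assoc, toricInclusion_actHom, Category.assoc,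
    toricInclusion_fanHom, ← Category.assoc, ← Category.assoc, toricInclusion_fanHom,
    Category.assoc (fanChartMap k τ σ), toricInclusion_actHom, ← Category.assoc, fanChartMap,
    ← chartMap_comp, ← chartMap_comp]
  congr 2
  ext m
  simp

/-- The morphism `τ ↦ f_τ` from `Aut_Δ M` to `Aut_to X`. It is contravariant,
`f_{τ ∘ τ'} = f_{τ'} ∘ f_τ`, so its source is the opposite group. -/
def fanToToricAut : (autFan Δ)ᵐᵒᵖ →* toricAut k Δ where
  toFun τ := ⟨(fanAut k τ.unop, torusAutOfEquiv τ.unop.1), fanAut_mem k τ.unop⟩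
  map_one' := by
    ext1
    exact Prod.ext (Iso.ext (fanHom_one k)) torusAutOfEquiv_one
  map_mul' τ τ' := by
    ext1
    exact Prod.ext (Iso.ext (fanHom_mul k _ _)) (torusAutOfEquiv_mul _ _)

variable (Δ)

/-- The natural morphism `Aut_Δ M → Aut_to X / T_M`, `τ ↦ [f_τ]`. -/
def naturalHom : (autFan Δ)ᵐᵒᵖ →* toricAut k Δ ⧸ (torusToToricAut k Δ).range :=
  (QuotientGroup.mk' _).comp (fanToToricAut k)

end Automorphisms

end Toric
end

/-! Write `τ^*` for the transpose on cones. A toric automorphism is a pair `(f, Φ)`. The Hopf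
algebra `k[M]` has the monomials as its group-like elements, so `Φ` comes from a lattice
automorphism `τ` (`torusAutOfEquiv_surjective`). What remains is that `τ` preserves the fan and that
`f` is `f_τ` up to a translation by a point of the torus.

Both rest on the restriction of `f` to the open orbit (`exists_torus_restriction`). The generic
point goes into that orbit, so `f` gives a homomorphism `k[M] → k(M)`. Equivariance makes the image
of `x^m` semi-invariant of weight `τ(m)`. A semi-invariant rational function is a monomial, because
its ideal of denominators is stable under the torus and so contains a monomial, a unit of `k[M]`
(`exists_eq_monomial`). Hence `x^m ↦ c(m) x^{τ(m)}` with `c` a character. As `X` is separated and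
the torus is dense in every chart, `f = h_c ∘ f_τ` as soon as `f_τ` makes sense.

For the fan, a stable open subset of `U_σ` that contains the distinguished point is all of `U_σ`. So
`f` maps `U_σ` into some `U_σ'` (`exists_range_subset`). Comparing monomials gives `τ(S_σ') ⊆ S_σ`,
and cone duality turns this into `τ^*(σ) ⊆ σ'`. The same for the inverse of `f` puts `σ` and
`(τ⁻¹)^*(σ')` in a chain below a cone of the fan; then `σ` is a face of `(τ⁻¹)^*(σ')`, so `τ^*(σ)`
is a face of `σ'` (`mem_autFan_of_equivariant`).

Injectivity holds because the points of the torus separate `M`: in characteristic `0` the element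
`2` has infinite order in the group of units. -/

noncomputable section

open CategoryTheory Limits AlgebraicGeometry Opposite

namespace Toric

/-! ### Duality of rational cones -/

section Duality

variable {M : Type u} [AddCommGroup M]

/-- Farkas' lemma for rational linear forms on a lattice. -/
lemma farkas {ι : Type*} [DecidableEq ι] (s : Finset ι) (a : ι → DualQ M) (b : DualQ M)
    (h : ∀ x, (∀ i ∈ s, 0 ≤ a i x) → 0 ≤ b x) :
    ∃ c : ι → ℚ, (∀ i, 0 ≤ c i) ∧ b = ∑ i ∈ s, c i • a i := by
  induction s using Finset.induction_on generalizing a b with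
  | empty =>
    refine ⟨0, fun _ => le_rfl, LinearMap.ext fun x => ?_⟩
    have h1 := h x (by simp)
    have h2 := h (-x) (by simp)
    rw [map_neg] at h2
    simpa using le_antisymm (by linarith) h1
  | insert j s hj ih =>
    by_cases hs : ∀ x, (∀ i ∈ s, 0 ≤ a i x) → 0 ≤ b x
    · obtain ⟨c, hc, rfl⟩ := ih a b hs
      refine ⟨Function.update c j 0, fun i => ?_, ?_⟩
      · by_cases hi : i = j
        · subst hi; simp
        · simpa [hi] using hc i
      · rw [Finset.sum_insert hj]
        simp only [Function.update_self, zero_smul, zero_add]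
        refine Finset.sum_congr rfl fun i hi => ?_
        rw [Function.update_of_ne (ne_of_mem_of_not_mem hi hj)]
    · push Not at hs
      obtain ⟨y, hy, hby⟩ := hs
      have hp : a j y < 0 := by
        by_contra! hp
        exact hby.not_ge (h y (by simpa using ⟨hp, hy⟩))
      let p : ℚ := -(a j y)
      have hp0 : 0 < p := by simp only [p]; linarith
      -- Project `x` along `y` onto the hyperplane `a j = 0`, that is, take `x + (a j x / p) y`.
      -- Multiplying by the denominator of `a j x / p` keeps the point in the lattice. On linear
      -- forms the projection is `d ↦ d + (d y / p) a j`, which kills `a j`.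
      have key : ∀ (d : DualQ M) (x : M),
          d ((a j x / p).den • x + (a j x / p).num • y) =
            (a j x / p).den * (d + (d y / p) • a j) x := by
        intro d x
        have h1 : ((a j x / p).den : ℚ) * (a j x / p) = (a j x / p).num := Rat.den_mul_eq_num _
        simp only [map_add, map_nsmul, map_zsmul, LinearMap.add_apply, LinearMap.smul_apply,
          nsmul_eq_mul, zsmul_eq_mul, smul_eq_mul, ← h1]
        field_simp
      obtain ⟨c, hc, hb⟩ := ih (fun i => a i + (a i y / p) • a j) (b + (b y / p) • a j) (by
        intro x hx
        have hden : (0 : ℚ) < (a j x / p).den := by exact_mod_cast (a j x / p).den_pos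
        refine nonneg_of_mul_nonneg_right ((key b x).symm ▸ h _ fun i hi => ?_) hden
        rcases Finset.mem_insert.1 hi with rfl | hi
        · rw [key]
          refine le_of_eq ?_
          have : a i y / p = -1 := by rw [div_neg, div_self hp.ne]
          simp [this]
        · rw [key]
          exact mul_nonneg hden.le (hx i hi))
      -- The new coefficient collects all multiples of `a j` in the relation between the projected
      -- forms. It is nonnegative because `a i y ≥ 0` on `s` while `b y < 0`.
      refine ⟨Function.update c j (∑ i ∈ s, c i * (a i y / p) - b y / p), fun i => ?_, ?_⟩
      · by_cases hi : i = j
        · subst hi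
          rw [Function.update_self]
          have h1 : 0 ≤ ∑ i' ∈ s, c i' * (a i' y / p) :=
            Finset.sum_nonneg fun i hi => mul_nonneg (hc i) (div_nonneg (hy i hi) hp0.le)
          have h2 : b y / p ≤ 0 := div_nonpos_of_nonpos_of_nonneg hby.le hp0.le
          linarith
        · rw [Function.update_of_ne hi]; exact hc i
      · rw [Finset.sum_insert hj, Function.update_self]
        have : ∑ i ∈ s, Function.update c j (∑ i ∈ s, c i * (a i y / p) - b y / p) i • a i =
            ∑ i ∈ s, c i • a i := Finset.sum_congr rfl fun i hi => by
          rw [Function.update_of_ne (ne_of_mem_of_not_mem hi hj)]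
        rw [this]
        refine (eq_sub_of_add_eq hb).trans ?_
        simp only [smul_add, Finset.sum_add_distrib, smul_smul, ← Finset.sum_smul, sub_smul]
        abel

/-- A finitely generated cone is determined by the monoid of lattice points nonnegative on it. -/
lemma mem_of_forall_dualMonoid {σ : PointedCone ℚ (DualQ M)} (hσ : σ.FG) {v : DualQ M}
    (hv : ∀ m ∈ dualMonoid σ, 0 ≤ v m) : v ∈ σ := by
  classical
  obtain ⟨s, rfl⟩ := hσ
  obtain ⟨c, hc, rfl⟩ := farkas s id v fun x hx => hv x fun w hw => by
    induction hw using Submodule.span_induction with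
    | mem w hw => exact hx w hw
    | zero => simp
    | add _ _ _ _ h1 h2 => exact add_nonneg h1 h2
    | smul a _ _ h1 => exact mul_nonneg a.2 h1
  exact Submodule.sum_mem _ fun i hi =>
    Submodule.smul_mem _ (⟨c i, hc i⟩ : {c : ℚ // 0 ≤ c}) (Submodule.subset_span hi)

/-- Take a minimal face of `σ`, cut out by some `m`. Adding any `m'` of the dual monoid to `m` can
only shrink the face, so by minimality `m'` vanishes on it. A vector `v` of the face is thus killed
by the whole dual monoid; then `-v ∈ σ` by duality, and strong convexity gives `v = 0`. -/
lemma Fan.bot_mem (Δ : Fan M) : ⊥ ∈ Δ.cones := by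
  obtain ⟨σ, hσ⟩ := Δ.nonempty
  let face (m : M) : PointedCone ℚ (DualQ M) := σ ⊓
    { carrier := {v | v m = 0}
      add_mem' := fun ha hb => by simp_all
      zero_mem' := by simp
      smul_mem' := fun c x hx => by
        have hx : x m = 0 := hx
        change c.1 * x m = 0
        rw [hx, mul_zero] }
  let F := {ρ | ∃ m ∈ dualMonoid σ, face m = ρ}
  have hF : F.Finite := Δ.finite.subset (by
    rintro _ ⟨m, hm, rfl⟩
    exact Δ.face_mem σ hσ _ ⟨m, hm, fun v => Iff.rfl⟩)
  obtain ⟨_, ⟨m, hm, rfl⟩, hmin⟩ := hF.exists_minimal ⟨_, 0, zero_mem _, rfl⟩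
  have hzero : ∀ v ∈ face m, v = 0 := by
    rintro v ⟨hvσ, hvm⟩
    refine Δ.pointed σ hσ v hvσ (mem_of_forall_dualMonoid (Δ.fg σ hσ) fun m' hm' => ?_)
    have hle : face (m + m') ≤ face m := by
      rintro w ⟨hw, hw'⟩
      have hw' : w (m + m') = 0 := hw'
      rw [map_add] at hw'
      exact ⟨hw, show w m = 0 by linarith [hm w hw, hm' w hw]⟩
    have := (hmin ⟨m + m', add_mem hm hm', rfl⟩ hle ⟨hvσ, hvm⟩).2
    have h1 : v (m + m') = 0 := this
    have h2 : v m = 0 := hvm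
    rw [map_add, h2, zero_add] at h1
    simp [h1]
  have : face m = ⊥ := (Submodule.eq_bot_iff _).2 hzero
  rw [← this]
  exact Δ.face_mem σ hσ _ ⟨m, hm, fun v => Iff.rfl⟩

end Duality

/-! ### Separation of monomials by points of the torus -/

section Characters

variable (k : Type u) [Field k] {M : Type u} [AddCommGroup M]

/-- Take the character `2 ^ (i-th coordinate)` for a coordinate in which `m` and `n` differ. Powers
of `2` are distinct in `ℚ`, which embeds in `k`. -/
lemma exists_torusPoints_ne [CharZero k] [Module.Free ℤ M] {m n : M} (h : m ≠ n) :
    ∃ χ : torusPoints k M, χ (.ofAdd m) ≠ χ (.ofAdd n) := by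
  let b := Module.Free.chooseBasis ℤ M
  obtain ⟨i, hi⟩ : ∃ i, b.repr m i ≠ b.repr n i := by
    by_contra! H
    exact h (b.repr.injective (Finsupp.ext H))
  let two : kˣ := Units.mk0 2 two_ne_zero
  refine ⟨(zpowersHom kˣ two).comp (AddMonoidHom.toMultiplicative (b.coord i).toAddMonoidHom),
    fun H => hi ?_⟩
  have H' : two ^ (b.repr m i) = two ^ (b.repr n i) := H
  have H2 : ((2 : ℚ) : k) ^ (b.repr m i) = ((2 : ℚ) : k) ^ (b.repr n i) := by
    simpa [two] using congrArg (fun z : kˣ => (z : k)) H'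
  rw [← Rat.cast_zpow, ← Rat.cast_zpow, Rat.cast_inj] at H2
  exact zpow_right_injective₀ (by norm_num) (by norm_num) H2

variable {k}

lemma actAlg_coeff (χ : torusPoints k M) (σ : PointedCone ℚ (DualQ M)) (a : coordAlg k σ)
    (m : dualMonoid σ) : (actAlg k χ σ a).coeff m = a.coeff m * χ (.ofAdd (m : M)) := by
  classical
  induction a using AddMonoidAlgebra.induction_linear with
  | zero => simp
  | add f g hf hg => simp [hf, hg, add_mul]
  | single n c =>
    rw [actAlg_single, AddMonoidAlgebra.coeff_single, AddMonoidAlgebra.coeff_single,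
      Finsupp.single_apply, Finsupp.single_apply]
    split_ifs with h
    · rw [h]
    · simp

/-- A subspace of `k[S_σ]` stable under the torus contains the monomial components of its
elements. -/
lemma single_mem_of_actAlg_mem [CharZero k] [Module.Free ℤ M] {σ : PointedCone ℚ (DualQ M)}
    (V : Submodule k (coordAlg k σ))
    (hV : ∀ χ, ∀ a ∈ V, actAlg k χ σ a ∈ V) {a : coordAlg k σ} (ha : a ∈ V) (m : dualMonoid σ) :
    AddMonoidAlgebra.single m (a.coeff m) ∈ V := by
  classical
  -- The unwanted exponents are removed one at a time. The last clause says that no new exponent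
  -- appears, so it is enough to take for `B` the support without `m`.
  suffices H : ∀ B : Finset (dualMonoid σ), m ∉ B → ∃ a' ∈ V, a'.coeff m = a.coeff m ∧
      (∀ n ∈ B, a'.coeff n = 0) ∧ ∀ n, a.coeff n = 0 → a'.coeff n = 0 by
    obtain ⟨a', ha', h1, h2, h3⟩ := H (a.coeff.support.erase m) (by simp)
    convert ha'
    ext n
    rw [AddMonoidAlgebra.coeff_single, Finsupp.single_apply]
    split_ifs with hn
    · rw [← hn, h1]
    · by_cases hn' : a.coeff n = 0
      · exact (h3 n hn').symm
      · exact (h2 n (by simp [hn', Ne.symm hn])).symm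
  intro B
  induction B using Finset.induction_on with
  | empty => exact fun _ => ⟨a, ha, rfl, by simp, fun _ h => h⟩
  | insert n B hn ih =>
    intro hm
    rw [Finset.mem_insert, not_or] at hm
    obtain ⟨a', ha', h1, h2, h3⟩ := ih hm.2
    obtain ⟨χ, hχ⟩ := exists_torusPoints_ne k (m := (m : M)) (n := n)
      fun h => hm.1 (Subtype.ext h)
    have hχ' : (χ (.ofAdd (m : M)) : k) - χ (.ofAdd (n : M)) ≠ 0 :=
      sub_ne_zero.2 fun h => hχ (Units.ext h)
    -- The operator `h_χ - χ(n)` kills `x^n` and multiplies `x^m` by `χ(m) - χ(n)`, which the scalar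
    -- in front normalises.
    refine ⟨((χ (.ofAdd (m : M)) : k) - χ (.ofAdd (n : M)))⁻¹ •
      (actAlg k χ σ a' - (χ (.ofAdd (n : M)) : k) • a'),
      V.smul_mem _ (V.sub_mem (hV _ _ ha') (V.smul_mem _ ha')), ?_, fun l hl => ?_, fun l hl => ?_⟩
    · simp only [AddMonoidAlgebra.coeff_smul, AddMonoidAlgebra.coeff_sub, Finsupp.smul_apply,
        Finsupp.sub_apply, actAlg_coeff, smul_eq_mul, h1]
      field_simp
    · simp only [AddMonoidAlgebra.coeff_smul, AddMonoidAlgebra.coeff_sub, Finsupp.smul_apply,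
        Finsupp.sub_apply, actAlg_coeff, smul_eq_mul]
      rcases Finset.mem_insert.1 hl with rfl | hl
      · ring
      · simp [h2 l hl]
    · simp [actAlg_coeff, h3 l hl]

end Characters

/-! ### The function field and its semi-invariants -/

section GenericPoint

variable {k : Type u} [Field k] {M : Type u} [AddCommGroup M]

/-- `S_σ` embeds in a free abelian group, so it has unique sums, and these exclude zero divisors in
its monoid algebra. -/
instance isDomain_coordAlg [Module.Free ℤ M] (σ : PointedCone ℚ (DualQ M)) :
    IsDomain (coordAlg k σ) := by
  let b := Module.Free.chooseBasis ℤ M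
  have : UniqueSums (dualMonoid σ) := UniqueSums.of_injective_addHom
    (b.repr.toAddEquiv.toAddMonoidHom.comp (dualMonoid σ).subtype).toAddHom
    (b.repr.injective.comp Subtype.val_injective) inferInstance
  exact NoZeroDivisors.to_isDomain _

lemma actAlg_injective (χ : torusPoints k M) (σ : PointedCone ℚ (DualQ M)) :
    Function.Injective (actAlg k χ σ) := by
  refine Function.LeftInverse.injective (g := actAlg k χ⁻¹ σ) fun a => ?_
  change ((actAlg k χ⁻¹ σ).comp (actAlg k χ σ)) a = AlgHom.id k _ a
  congr 1
  ext m
  simp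

variable (k M) in
/-- The function field `k(M)` of the toric varieties with torus `Spec k[M]`. -/
abbrev ratField [Module.Free ℤ M] : Type u := FractionRing (coordAlg k (⊥ : PointedCone ℚ (DualQ M)))

lemma mem_dualMonoid_bot (m : M) : m ∈ dualMonoid (⊥ : PointedCone ℚ (DualQ M)) := by
  intro v hv
  rw [(Submodule.mem_bot _).1 hv]
  simp

variable (k) in
/-- The monomial `c x^m` of `k[M]`. -/
abbrev monomial (m : M) (c : k) : coordAlg k (⊥ : PointedCone ℚ (DualQ M)) :=
  AddMonoidAlgebra.single ⟨m, mem_dualMonoid_bot m⟩ c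

lemma monomial_zero_one : monomial k (0 : M) 1 = 1 := rfl

lemma monomial_mul_monomial (m n : M) (a b : k) :
    monomial k m a * monomial k n b = monomial k (m + n) (a * b) :=
  AddMonoidAlgebra.single_mul_single ..

variable [Module.Free ℤ M]

/-- The action of the points of the torus on the function field. -/
def actField (χ : torusPoints k M) : ratField k M →ₐ[k] ratField k M :=
  IsFractionRing.liftAlgHom (A := coordAlg k (⊥ : PointedCone ℚ (DualQ M)))
    (g := (Algebra.algHom k _ (ratField k M)).comp (actAlg k χ ⊥))
    (by
      rw [AlgHom.coe_comp]
      exact (IsFractionRing.injective _ (ratField k M)).comp (actAlg_injective χ ⊥))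

lemma actField_algebraMap (χ : torusPoints k M) (a : coordAlg k (⊥ : PointedCone ℚ (DualQ M))) :
    actField χ (algebraMap _ (ratField k M) a) = algebraMap _ _ (actAlg k χ ⊥ a) := by
  exact (IsFractionRing.liftAlgHom_apply _ _).trans (IsFractionRing.lift_algebraMap _ _)

/-- The semi-invariant rational functions are the monomials. -/
lemma exists_eq_monomial [CharZero k] (n : M) (u : ratField k M)
    (hu : ∀ χ : torusPoints k M, actField χ u = (χ (.ofAdd n) : k) • u) :
    ∃ c : k, u = algebraMap _ _ (monomial k n c) := by
  let A := coordAlg k (⊥ : PointedCone ℚ (DualQ M))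
  let φ : A →ₗ[A] ratField k M := Algebra.linearMap _ _
  have algebraMap_smul_eq (c : k) (a : A) :
      algebraMap A (ratField k M) (c • a) = c • algebraMap A (ratField k M) a :=
    map_smul (Algebra.algHom k A (ratField k M)) c a
  -- The denominators of `u`: the `b` with `b u ∈ k[M]`. Semi-invariance of `u` makes this space
  -- stable under the torus.
  let I : Submodule k A :=
    ((LinearMap.range φ).comap (LinearMap.toSpanSingleton A _ u)).restrictScalars k
  have hI : ∀ b : A, b ∈ I ↔ ∃ a : A, algebraMap A (ratField k M) a = algebraMap A _ b * u := by
    intro b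
    simp [I, φ, Algebra.smul_def]
  have hact : ∀ χ, ∀ b ∈ I, actAlg k χ ⊥ b ∈ I := by
    intro χ b hb
    obtain ⟨a, ha⟩ := (hI b).1 hb
    refine (hI _).2 ⟨(χ (.ofAdd n) : k)⁻¹ • actAlg k χ ⊥ a, ?_⟩
    have := congrArg (actField χ) ha
    rw [map_mul, actField_algebraMap, actField_algebraMap, hu] at this
    rw [algebraMap_smul_eq, this, mul_smul_comm, smul_smul, inv_mul_cancel₀ (Units.ne_zero _),
      one_smul]
  obtain ⟨b, hb0, hbI⟩ : ∃ b ≠ 0, b ∈ I := by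
    obtain ⟨a, b, hb, rfl⟩ := IsFractionRing.div_surjective (A := A) u
    have hb0 : b ≠ 0 := nonZeroDivisors.ne_zero hb
    refine ⟨b, hb0, (hI b).2 ⟨a, ?_⟩⟩
    rw [mul_div_cancel₀]
    exact (map_ne_zero_iff _ (IsFractionRing.injective A _)).2 hb0
  -- The monomial component of `b` at `m` is again a denominator of `u`. It is a unit of `k[M]`,
  -- hence `u ∈ k[M]`.
  obtain ⟨m, hm⟩ : ∃ m, b.coeff m ≠ 0 := by
    by_contra! H
    exact hb0 (by ext m; simpa using H m)
  obtain ⟨a', ha'⟩ := (hI _).1 (single_mem_of_actAlg_mem I hact hbI m)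
  obtain ⟨a, rfl⟩ : ∃ a : A, algebraMap A _ a = u := by
    refine ⟨monomial k (-m : M) (b.coeff m)⁻¹ * a', ?_⟩
    rw [map_mul, ha', ← mul_assoc, ← map_mul, AddMonoidAlgebra.single_mul_single,
      inv_mul_cancel₀ hm]
    have : (⟨-m, mem_dualMonoid_bot _⟩ + m : dualMonoid (⊥ : PointedCone ℚ (DualQ M))) = 0 :=
      Subtype.ext (neg_add_cancel (m : M))
    rw [this, ← AddMonoidAlgebra.one_def, map_one, one_mul]
  refine ⟨a.coeff ⟨n, mem_dualMonoid_bot n⟩, congrArg _ ?_⟩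
  classical
  ext l
  rw [AddMonoidAlgebra.coeff_single, Finsupp.single_apply]
  split_ifs with hl
  · rw [hl]
  -- A nonzero coefficient at `l` would force `χ(l) = χ(n)` for every `χ`.
  · obtain ⟨χ, hχ⟩ := exists_torusPoints_ne k (m := (l : M)) (n := n)
      fun h => hl (Subtype.ext h.symm)
    have h1 := hu χ
    rw [actField_algebraMap, ← algebraMap_smul_eq] at h1
    have h2 := congrArg (fun z => z.coeff l) (IsFractionRing.injective A _ h1)
    rw [actAlg_coeff] at h2
    by_contra h0
    rw [mul_comm] at h2
    exact hχ (Units.ext (mul_right_cancel₀ h0 h2))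

end GenericPoint

/-! ### Affine schemes over `k`, and density -/

section AlgSpec

variable (k : Type u) [Field k]

/-- The affine scheme `Spec A` over `k`. -/
abbrev specOver (A : Type u) [CommRing A] [Algebra k A] : Over (Spec (.of k)) :=
  (algSpec (.of k)).obj (op (CommAlgCat.of k A))

variable {k} {A B C : Type u} [CommRing A] [Algebra k A] [CommRing B] [Algebra k B]
  [CommRing C] [Algebra k C]

/-- The morphism `Spec B → Spec A` over `k` dual to `A → B`. -/
def specMap (f : A →ₐ[k] B) : specOver k B ⟶ specOver k A :=
  (algSpec (.of k)).map (CommAlgCat.ofHom f).op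

lemma specMap_comp (f : A →ₐ[k] B) (g : B →ₐ[k] C) :
    specMap (g.comp f) = specMap g ≫ specMap f := by
  rw [specMap, CommAlgCat.ofHom_comp, op_comp, Functor.map_comp]; rfl

lemma exists_specMap_eq (g : specOver k B ⟶ specOver k A) : ∃ f : A →ₐ[k] B, specMap f = g := by
  exact ⟨(algSpec.fullyFaithful.preimage g).unop.hom, algSpec.fullyFaithful.map_preimage g⟩

lemma specMap_injective : Function.Injective (specMap : (A →ₐ[k] B) → _) := by
  intro f g h
  exact congrArg (fun z : op (CommAlgCat.of k B) ⟶ op (.of k A) => z.unop.hom)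
    (algSpec.fullyFaithful.map_injective h)

lemma denseRange_specMap [IsDomain B] {f : A →ₐ[k] B} (hf : Function.Injective f) :
    DenseRange (specMap f).left := by
  refine (PrimeSpectrum.denseRange_comap_iff_ker_le_nilRadical f.toRingHom).2 ?_
  rw [(RingHom.injective_iff_ker_eq_bot f.toRingHom).1 hf]
  exact bot_le

/-- The image of `Spec B` is dense in the reduced scheme `Spec A`, and the locus where two morphisms
to a separated scheme agree is closed. This is where separatedness of `X` is used. -/
lemma hom_ext_of_specMap [IsDomain A] [IsDomain B] {X : Over (Spec (.of k))} [IsSeparated X.hom]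
    {f : A →ₐ[k] B} (hf : Function.Injective f) {g h : specOver k A ⟶ X}
    (H : specMap f ≫ g = specMap f ≫ h) : g = h := by
  have : IsDominant (specMap f).left := ⟨denseRange_specMap hf⟩
  have : IsReduced (specOver k A).left := inferInstanceAs (IsReduced (Spec (.of A)))
  refine Over.OverMorphism.ext (ext_of_isDominant_of_isSeparated X.hom ?_ (specMap f).left ?_)
  · rw [Over.w, Over.w]
  · rw [← Over.comp_left, H, Over.comp_left]

end AlgSpec

/-! ### The charts as an open cover of `X` -/

section Charts

variable (k : Type u) [Field k] {M : Type u} [AddCommGroup M] (Δ : Fan M)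

instance chartDiagram_forget_isOpenImmersion {σ τ : Δ.cones} (f : σ ⟶ τ) :
    IsOpenImmersion ((chartDiagram k Δ ⋙ Over.forget _).map f) :=
  chartDiagram_isOpenImmersion k Δ f

instance chartDiagram_forget_isLocallyDirected :
    ((chartDiagram k Δ ⋙ Over.forget _) ⋙ Scheme.forget).IsLocallyDirected :=
  chartDiagram_isLocallyDirected k Δ

/-- The underlying scheme of `X` is the colimit of the underlying schemes of the charts. -/
def toricVarietyLeftIso :
    (toricVariety k Δ).left ≅ colimit (chartDiagram k Δ ⋙ Over.forget _) :=
  preservesColimitIso (Over.forget _) (chartDiagram k Δ)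

lemma toricInclusion_left_iso (σ : Δ.cones) :
    (toricInclusion k Δ σ).left ≫ (toricVarietyLeftIso k Δ).hom =
      colimit.ι (chartDiagram k Δ ⋙ Over.forget _) σ :=
  ι_preservesColimitIso_hom (Over.forget _) (chartDiagram k Δ) σ

instance toricInclusion_isOpenImmersion (σ : Δ.cones) :
    IsOpenImmersion (toricInclusion k Δ σ).left := by
  rw [← MorphismProperty.cancel_right_of_respectsIso (P := @IsOpenImmersion) _
    (toricVarietyLeftIso k Δ).hom, toricInclusion_left_iso]
  exact Scheme.IsLocallyDirected.instIsOpenImmersionι _ _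

instance toricInclusion_mono (σ : Δ.cones) : Mono (toricInclusion k Δ σ) :=
  Over.mono_of_mono_left _

lemma toricInclusion_jointly_surjective (x : (toricVariety k Δ).left) :
    ∃ (σ : Δ.cones) (y : (chart k σ.1).left), (toricInclusion k Δ σ).left y = x := by
  obtain ⟨σ, y, hy⟩ := Scheme.IsLocallyDirected.ι_jointly_surjective
    (chartDiagram k Δ ⋙ Over.forget _) ((toricVarietyLeftIso k Δ).hom x)
  refine ⟨σ, y, (toricVarietyLeftIso k Δ).hom.isOpenEmbedding.injective ?_⟩
  rw [← hy, ← toricInclusion_left_iso]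
  rfl

variable {k Δ}

lemma exists_eq_specMap_comp {A : Type u} [CommRing A] [Algebra k A] (σ : Δ.cones)
    (g : specOver k A ⟶ toricVariety k Δ)
    (h : Set.range g.left ⊆ Set.range (toricInclusion k Δ σ).left) :
    ∃ f : coordAlg k σ.1 →ₐ[k] A, g = specMap f ≫ toricInclusion k Δ σ := by
  let l : specOver k A ⟶ chart k σ.1 :=
    Over.homMk (IsOpenImmersion.lift (toricInclusion k Δ σ).left g.left h) (by
      rw [← Over.w (toricInclusion k Δ σ), IsOpenImmersion.lift_fac_assoc, Over.w])
  obtain ⟨f, hf⟩ := exists_specMap_eq l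
  refine ⟨f, Over.OverMorphism.ext ?_⟩
  rw [hf]
  exact (IsOpenImmersion.lift_fac _ _ _).symm

end Charts

/-! ### Automorphisms of the torus -/

section Hopf

variable {k : Type u} [Field k] {M : Type u} [AddCommGroup M]

/-- The automorphisms of the group scheme `T_M` are those given by the automorphisms of `M`. -/
lemma torusAutOfEquiv_surjective (Φ : Aut (torus k M)) :
    ∃ τ : M ≃ₗ[ℤ] M, torusAutOfEquiv τ = Φ := by
  let H := CommHopfAlgCat.of k (AddMonoidAlgebra k M)
  let e : op H ≅ op H := (hopfSpec.fullyFaithful (R := .of k)).preimageIso Φ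
  have he : (hopfSpec (.of k)).mapIso e = Φ :=
    Iso.ext ((hopfSpec.fullyFaithful (R := .of k)).map_preimage Φ.hom)
  let f : AddMonoidAlgebra k M →ₐc[k] AddMonoidAlgebra k M := e.hom.unop.hom
  let g : AddMonoidAlgebra k M →ₐc[k] AddMonoidAlgebra k M := e.inv.unop.hom
  have hfg : f.comp g = .id k _ := congrArg (fun z : op H ⟶ op H => z.unop.hom) e.hom_inv_id
  have hgf : g.comp f = .id k _ := congrArg (fun z : op H ⟶ op H => z.unop.hom) e.inv_hom_id
  -- A bialgebra map permutes group-like elements, which in `k[M]` are the monomials `x^m`; so `f`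
  -- and `g` come from mutually inverse maps of `M`.
  let τ : M ≃+ M := (AddMonoidAlgebra.mapDomainOfBialgHom f).toAddEquiv
    (AddMonoidAlgebra.mapDomainOfBialgHom g)
    (by rw [← AddMonoidAlgebra.mapDomainOfBialgHom_comp, hgf,
      AddMonoidAlgebra.mapDomainOfBialgHom_id])
    (by rw [← AddMonoidAlgebra.mapDomainOfBialgHom_comp, hfg,
      AddMonoidAlgebra.mapDomainOfBialgHom_id])
  refine ⟨τ.toIntLinearEquiv, ?_⟩
  rw [← he, torusAutOfEquiv]
  congr 1
  refine Iso.ext (Quiver.Hom.unop_inj (CommHopfAlgCat.hom_ext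
    (AddMonoidAlgebra.bialgHom_ext (fun m => ?_) (Subsingleton.elim _ _))))
  exact AddMonoidAlgebra.mapDomain_single.trans
    (AddMonoidAlgebra.single_mapDomainOfBialgHom f m 1)

end Hopf

/-! ### Equivariant morphisms on the open orbit and on the charts -/

section Equivariant

variable {k : Type u} [Field k] {M : Type u} [AddCommGroup M]

/-- The image `χ ∘ τ` of a point `χ` of the torus under the automorphism given by `τ`. -/
abbrev pullPoint (τ : M ≃ₗ[ℤ] M) (χ : torusPoints k M) : torusPoints k M :=
  χ.comp (AddMonoidHom.toMultiplicative τ.toAddEquiv.toAddMonoidHom)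

/-- The morphism `k[S_σ'] → k[S_σ]`, `x^m ↦ c(m) x^{τ(m)}`. -/
def twistMap (c : torusPoints k M) (τ : M ≃ₗ[ℤ] M) {σ σ' : PointedCone ℚ (DualQ M)}
    (h : ∀ m ∈ dualMonoid σ', τ.toAddEquiv.toAddMonoidHom m ∈ dualMonoid σ) :
    coordAlg k σ' →ₐ[k] coordAlg k σ :=
  (coordMap k τ.toAddEquiv.toAddMonoidHom h).comp (actAlg k c σ')

lemma twistMap_single (c : torusPoints k M) (τ : M ≃ₗ[ℤ] M) {σ σ' : PointedCone ℚ (DualQ M)}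
    (h : ∀ m ∈ dualMonoid σ', τ.toAddEquiv.toAddMonoidHom m ∈ dualMonoid σ) (m : dualMonoid σ')
    (a : k) : twistMap c τ h (AddMonoidAlgebra.single m a) =
      AddMonoidAlgebra.single ⟨τ m, h m m.2⟩ (a * c (.ofAdd (m : M))) := by
  rw [twistMap, AlgHom.comp_apply, actAlg_single, coordMap_single]
  rfl

variable (k) in
/-- The inclusion of `k[S_σ]` in `k[M]`. -/
abbrev toTorusAlg (σ : PointedCone ℚ (DualQ M)) :
    coordAlg k σ →ₐ[k] coordAlg k (⊥ : PointedCone ℚ (DualQ M)) :=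
  coordMap k _ (dualMonoid_anti bot_le)

lemma toTorusAlg_coeff_of_notMem {σ : PointedCone ℚ (DualQ M)} {m : M} (hm : m ∉ dualMonoid σ)
    (a : coordAlg k σ) : (toTorusAlg k σ a).coeff ⟨m, mem_dualMonoid_bot m⟩ = 0 := by
  induction a using AddMonoidAlgebra.induction_linear with
  | zero => simp
  | add f g hf hg => simp [hf, hg]
  | single n c =>
    rw [coordMap_single, AddMonoidAlgebra.coeff_single]
    refine Finsupp.single_eq_of_ne fun h => hm ?_
    have h' : m = n := congrArg Subtype.val h
    exact h' ▸ n.2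

lemma toTorusAlg_injective (σ : PointedCone ℚ (DualQ M)) :
    Function.Injective (toTorusAlg k σ) :=
  AddMonoidAlgebra.mapDomain_injective fun _ _ hab =>
    Subtype.ext (congrArg (fun z : dualMonoid (⊥ : PointedCone ℚ (DualQ M)) => (z : M)) hab)

/-- The endomorphism `x^m ↦ c(m) x^{τ(m)}` of `k[M]`. -/
def torusTwist (c : torusPoints k M) (τ : M ≃ₗ[ℤ] M) :
    coordAlg k (⊥ : PointedCone ℚ (DualQ M)) →ₐ[k] coordAlg k (⊥ : PointedCone ℚ (DualQ M)) :=
  twistMap c τ fun _ _ => mem_dualMonoid_bot _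

lemma torusTwist_monomial (c : torusPoints k M) (τ : M ≃ₗ[ℤ] M) (m : M) (a : k) :
    torusTwist c τ (monomial k m a) = monomial k (τ m) (a * c (.ofAdd m)) :=
  twistMap_single ..

variable {Δ : Fan M}

variable (Δ) in
/-- The zero cone of a fan. -/
abbrev Fan.botCone : Δ.cones := ⟨⊥, Δ.bot_mem⟩

lemma specMap_toTorusAlg_comp (σ : Δ.cones) :
    specMap (toTorusAlg k σ.1) ≫ toricInclusion k Δ σ = toricInclusion k Δ Δ.botCone :=
  toricInclusion_w k Δ (σ := Δ.botCone) (τ := σ) bot_le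

/-- The distinguished point of `U_σ`: the monomials `x^m` take the value `1` if `m` vanishes on `σ`
and `0` otherwise. -/
lemma exists_distinguished_point (σ : PointedCone ℚ (DualQ M)) :
    ∃ p : PrimeSpectrum (coordAlg k σ), ∀ a ∉ p.asIdeal,
      ∃ m : dualMonoid σ, a.coeff m ≠ 0 ∧ -(m : M) ∈ dualMonoid σ := by
  classical
  let ε : coordAlg k σ →ₐ[k] k := AddMonoidAlgebra.lift k k _
    { toFun := fun m => if -(m.toAdd : M) ∈ dualMonoid σ then 1 else 0
      map_one' := if_pos (by simp)
      map_mul' := fun m n => by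
        -- The units of `S_σ` form a face of the monoid: `-m = -(m + n) + n`.
        have : -((m * n).toAdd : M) ∈ dualMonoid σ ↔
            -(m.toAdd : M) ∈ dualMonoid σ ∧ -(n.toAdd : M) ∈ dualMonoid σ := by
          change -((m.toAdd : M) + n.toAdd) ∈ _ ↔ _
          refine ⟨fun h => ⟨?_, ?_⟩, fun h => ?_⟩
          · convert add_mem h n.toAdd.2 using 1; abel
          · convert add_mem h m.toAdd.2 using 1; abel
          · convert add_mem h.1 h.2 using 1; abel
        simp only [this, ite_and, mul_ite, mul_one, mul_zero]
        split_ifs <;> rfl }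
  refine ⟨⟨RingHom.ker ε, RingHom.ker_isPrime ε⟩, fun a ha => ?_⟩
  by_contra! H
  refine ha ?_
  change ε a = 0
  rw [AddMonoidAlgebra.lift_apply]
  refine Finset.sum_eq_zero fun m _ => ?_
  by_cases hm : a.coeff m = 0
  · simp [hm]
  · have : -(m : M) ∉ dualMonoid σ := H m hm
    simp [this]

/-- Every chart is stable under the torus; apply `h_χ⁻¹`. -/
lemma mem_range_of_actHom_mem_range (χ : torusPoints k M) (σ : Δ.cones)
    {x : (toricVariety k Δ).left}
    (hx : (actHom k Δ χ).left x ∈ Set.range (toricInclusion k Δ σ).left) :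
    x ∈ Set.range (toricInclusion k Δ σ).left := by
  obtain ⟨y, hy⟩ := hx
  refine ⟨(specMap (actAlg k χ⁻¹ σ.1)).left y, ?_⟩
  have h1 : (toricInclusion k Δ σ).left ((specMap (actAlg k χ⁻¹ σ.1)).left y) =
      (toricInclusion k Δ σ ≫ actHom k Δ χ⁻¹).left y := by
    rw [toricInclusion_actHom]; rfl
  have h2 : (actHom k Δ χ ≫ actHom k Δ χ⁻¹).left x = x := by
    rw [← actHom_mul, torusPoints_inv_mul, actHom_one]; rfl
  rw [h1, ← h2]
  exact congrArg (actHom k Δ χ⁻¹).left hy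

variable [Module.Free ℤ M]

/-- An ideal of `k[S_σ]` that is stable under the torus is the unit ideal if it has an element in
which an invertible monomial occurs. -/
lemma eq_top_of_actAlg_mem [CharZero k] {σ : PointedCone ℚ (DualQ M)} (I : Ideal (coordAlg k σ))
    (hI : ∀ χ, ∀ a ∈ I, actAlg k χ σ a ∈ I) {a : coordAlg k σ} (ha : a ∈ I) {m : dualMonoid σ}
    (hm : a.coeff m ≠ 0) (hneg : -(m : M) ∈ dualMonoid σ) : I = ⊤ := by
  have h := single_mem_of_actAlg_mem (I.restrictScalars k) hI ha m
  refine I.eq_top_of_isUnit_mem h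
    (IsUnit.of_mul_eq_one (AddMonoidAlgebra.single ⟨-(m : M), hneg⟩ (a.coeff m)⁻¹) ?_)
  rw [AddMonoidAlgebra.single_mul_single, mul_inv_cancel₀ hm, AddMonoidAlgebra.one_def]
  congr 1
  exact Subtype.ext (add_neg_cancel (m : M))

/-- An open subset of `U_σ` that is stable under the torus and contains the distinguished point is
the whole of `U_σ`. -/
lemma eq_univ_of_comap_actAlg_mem [CharZero k] {σ : PointedCone ℚ (DualQ M)}
    {W : Set (PrimeSpectrum (coordAlg k σ))} (hW : IsOpen W)
    (hact : ∀ (χ : torusPoints k M) (q : PrimeSpectrum (coordAlg k σ)),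
      PrimeSpectrum.comap (actAlg k χ σ).toRingHom q ∈ W → q ∈ W)
    {p : PrimeSpectrum (coordAlg k σ)} (hpW : p ∈ W) (hp : ∀ a ∉ p.asIdeal,
      ∃ m : dualMonoid σ, a.coeff m ≠ 0 ∧ -(m : M) ∈ dualMonoid σ) : W = Set.univ := by
  -- The complement of `W` is closed and stable, so its ideal is stable. This ideal has an element
  -- outside `p`, in which an invertible monomial occurs; hence it is the unit ideal.
  have hzero : PrimeSpectrum.zeroLocus (PrimeSpectrum.vanishingIdeal Wᶜ : Set (coordAlg k σ)) =
      Wᶜ := by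
    rw [PrimeSpectrum.zeroLocus_vanishingIdeal_eq_closure, hW.isClosed_compl.closure_eq]
  have hpW' : p ∉ PrimeSpectrum.zeroLocus
      (PrimeSpectrum.vanishingIdeal Wᶜ : Set (coordAlg k σ)) := by
    rw [hzero]
    exact fun h => h hpW
  obtain ⟨a, ha, hap⟩ := Set.not_subset.1 hpW'
  obtain ⟨m, hm, hneg⟩ := hp a hap
  have hst : ∀ χ, ∀ b ∈ PrimeSpectrum.vanishingIdeal Wᶜ,
      actAlg k χ σ b ∈ PrimeSpectrum.vanishingIdeal Wᶜ := by
    intro χ b hb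
    rw [PrimeSpectrum.mem_vanishingIdeal] at hb ⊢
    exact fun q hq => hb _ fun h => hq (hact χ q h)
  have htop := eq_top_of_actAlg_mem (PrimeSpectrum.vanishingIdeal Wᶜ) hst ha hm hneg
  rw [htop, Submodule.top_coe, PrimeSpectrum.zeroLocus_univ] at hzero
  exact Set.compl_empty_iff.1 hzero.symm

variable (k M) in
/-- The inclusion of `k[M]` in its fraction field. -/
abbrev toRatField : coordAlg k (⊥ : PointedCone ℚ (DualQ M)) →ₐ[k] ratField k M :=
  Algebra.algHom k _ _

lemma toRatField_injective : Function.Injective (toRatField k M) :=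
  IsFractionRing.injective _ _

/-- The generic point is sent into the open orbit: the preimage of the orbit is open, and nonempty
because `f` is surjective, and the generic point is dense in every chart. -/
lemma exists_toTorusAlg_eq_of_isIso (f : toricVariety k Δ ⟶ toricVariety k Δ) [IsIso f] :
    ∃ φ : coordAlg k (⊥ : PointedCone ℚ (DualQ M)) →ₐ[k] ratField k M,
      specMap (toRatField k M) ≫ toricInclusion k Δ Δ.botCone ≫ f =
        specMap φ ≫ toricInclusion k Δ Δ.botCone := by
  refine exists_eq_specMap_comp Δ.botCone _ ?_
  let W : Set (toricVariety k Δ).left :=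
    f.left ⁻¹' Set.range (toricInclusion k Δ Δ.botCone).left
  have hW : IsOpen W :=
    (toricInclusion k Δ Δ.botCone).left.isOpenEmbedding.isOpen_range.preimage f.left.continuous
  obtain ⟨p⟩ : Nonempty (chart k (⊥ : PointedCone ℚ (DualQ M))).left :=
    inferInstanceAs (Nonempty (PrimeSpectrum (coordAlg k (⊥ : PointedCone ℚ (DualQ M)))))
  have : IsIso f.left := inferInstanceAs (IsIso ((Over.forget _).map f))
  obtain ⟨x, hx⟩ := f.left.homeomorph.surjective ((toricInclusion k Δ Δ.botCone).left p)
  obtain ⟨σ, y, rfl⟩ := toricInclusion_jointly_surjective k Δ x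
  obtain ⟨z, hz⟩ := (denseRange_specMap (f := (toRatField k M).comp (toTorusAlg k σ.1))
    (toRatField_injective.comp (toTorusAlg_injective σ.1))).exists_mem_open
    (hW.preimage (toricInclusion k Δ σ).left.continuous) ⟨y, p, hx.symm⟩
  rintro _ ⟨q, rfl⟩
  have : Subsingleton (specOver k (ratField k M)).left :=
    inferInstanceAs (Subsingleton (PrimeSpectrum (ratField k M)))
  rw [Subsingleton.elim q z]
  have h : (toricInclusion k Δ σ).left ((specMap ((toRatField k M).comp
      (toTorusAlg k σ.1))).left z) =
      (specMap (toRatField k M) ≫ toricInclusion k Δ Δ.botCone).left z := by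
    rw [← specMap_toTorusAlg_comp σ, ← Category.assoc, ← specMap_comp]
    rfl
  have hz' : f.left ((toricInclusion k Δ σ).left ((specMap ((toRatField k M).comp
      (toTorusAlg k σ.1))).left z)) ∈ Set.range (toricInclusion k Δ Δ.botCone).left := hz
  rw [h] at hz'
  rw [← Category.assoc]
  exact hz'

/-- The coefficients are determined by `φ`, so multiplicativity of `φ` passes to them. Their values
are units because `M` is a group. -/
lemma exists_eq_comp_torusTwist (τ : M ≃ₗ[ℤ] M)
    (φ : coordAlg k (⊥ : PointedCone ℚ (DualQ M)) →ₐ[k] ratField k M)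
    (h : ∀ m, ∃ c : k, φ (monomial k m 1) = toRatField k M (monomial k (τ m) c)) :
    ∃ c : torusPoints k M,
      φ = (toRatField k M).comp (torusTwist c τ) := by
  choose c hc using h
  have hinj : ∀ (m : M) (a b : k), toRatField k M (monomial k m a) =
      toRatField k M (monomial k m b) → a = b := fun m a b h =>
    AddMonoidAlgebra.single_right_injective (toRatField_injective h)
  let c' : Multiplicative M →* k :=
    { toFun := fun m => c m.toAdd
      map_one' := hinj (τ 0) _ _ (by
        change toRatField k M (monomial k (τ 0) (c 0)) = _
        rw [← hc, map_zero, monomial_zero_one, map_one, map_one])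
      map_mul' := fun m n => hinj (τ (m.toAdd + n.toAdd)) _ _ (by
        change toRatField k M (monomial k (τ (m.toAdd + n.toAdd)) (c (m.toAdd + n.toAdd))) = _
        rw [← hc, map_add, ← monomial_mul_monomial, map_mul, ← hc, ← hc, ← map_mul,
          monomial_mul_monomial, mul_one]) }
  refine ⟨c'.toHomUnits, AddMonoidAlgebra.algHom_ext (fun m => ?_) (Subsingleton.elim _ _)⟩
  rw [AlgHom.comp_apply]
  refine (hc m).trans (congrArg _ ?_)
  refine Eq.trans ?_ (torusTwist_monomial _ τ m 1).symm
  rw [one_mul]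
  rfl

/-- Both sides are compared as morphisms from `Spec k(M)` to `X`, which loses nothing since the
inclusion of the open orbit is a monomorphism. -/
lemma actField_comp_eq_of_equivariant (τ : M ≃ₗ[ℤ] M)
    (f : toricVariety k Δ ⟶ toricVariety k Δ)
    (hf : ∀ χ, actHom k Δ χ ≫ f = f ≫ actHom k Δ (pullPoint τ χ))
    (φ : coordAlg k (⊥ : PointedCone ℚ (DualQ M)) →ₐ[k] ratField k M)
    (hφ : specMap (toRatField k M) ≫ toricInclusion k Δ Δ.botCone ≫ f =
      specMap φ ≫ toricInclusion k Δ Δ.botCone) (χ : torusPoints k M) :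
    (actField χ).comp φ = φ.comp (actAlg k (pullPoint τ χ) ⊥) := by
  have hact : (actField χ).comp (toRatField k M) = (toRatField k M).comp (actAlg k χ ⊥) :=
    AlgHom.ext fun a => actField_algebraMap χ a
  apply specMap_injective
  rw [← cancel_mono (toricInclusion k Δ Δ.botCone), specMap_comp, specMap_comp, Category.assoc,
    Category.assoc, ← hφ, ← Category.assoc, ← specMap_comp, hact, specMap_comp]
  have h1 := toricInclusion_actHom k Δ χ Δ.botCone
  have h2 := toricInclusion_actHom k Δ (pullPoint τ χ) Δ.botCone
  change _ = specMap (actAlg k χ ⊥) ≫ _ at h1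
  change _ = specMap (actAlg k (pullPoint τ χ) ⊥) ≫ _ at h2
  rw [← h2, Category.assoc, ← Category.assoc (specMap (actAlg k χ ⊥)), ← h1, Category.assoc, hf,
    ← Category.assoc (specMap φ), ← hφ]
  simp only [Category.assoc]

lemma exists_monomial_of_actField_comp_eq [CharZero k] (τ : M ≃ₗ[ℤ] M)
    (φ : coordAlg k (⊥ : PointedCone ℚ (DualQ M)) →ₐ[k] ratField k M)
    (h : ∀ χ, (actField χ).comp φ = φ.comp (actAlg k (pullPoint τ χ) ⊥)) (m : M) :
    ∃ c : k, φ (monomial k m 1) = toRatField k M (monomial k (τ m) c) := by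
  refine exists_eq_monomial (τ m) _ fun χ => ?_
  have h1 := DFunLike.congr_fun (h χ) (monomial k m 1)
  rw [AlgHom.comp_apply, AlgHom.comp_apply, actAlg_single, one_mul] at h1
  rw [h1, ← map_smul, AddMonoidAlgebra.smul_single, smul_eq_mul, mul_one]
  rfl

/-- An equivariant automorphism of `X` is given by `x^m ↦ c(m) x^{τ(m)}` on the open orbit. -/
lemma exists_torus_restriction [CharZero k] [IsSeparated (toricVariety k Δ).hom] (τ : M ≃ₗ[ℤ] M)
    (f : toricVariety k Δ ⟶ toricVariety k Δ) [IsIso f]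
    (hf : ∀ χ, actHom k Δ χ ≫ f = f ≫ actHom k Δ (pullPoint τ χ)) :
    ∃ c : torusPoints k M, toricInclusion k Δ Δ.botCone ≫ f =
      specMap (torusTwist c τ) ≫ toricInclusion k Δ Δ.botCone := by
  obtain ⟨φ, hφ⟩ := exists_toTorusAlg_eq_of_isIso f
  obtain ⟨c, hc⟩ := exists_eq_comp_torusTwist τ φ (exists_monomial_of_actField_comp_eq τ φ
    (actField_comp_eq_of_equivariant τ f hf φ hφ))
  have h : specMap (toRatField k M) ≫ toricInclusion k Δ Δ.botCone ≫ f =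
      specMap (toRatField k M) ≫ specMap (torusTwist c τ) ≫ toricInclusion k Δ Δ.botCone := by
    rw [hφ, hc, specMap_comp, Category.assoc]
  exact ⟨c, hom_ext_of_specMap (f := toRatField k M) toRatField_injective h⟩

/-- An equivariant endomorphism of `X` maps every chart into a chart. -/
lemma exists_range_subset [CharZero k] (τ : M ≃ₗ[ℤ] M)
    (f : toricVariety k Δ ⟶ toricVariety k Δ)
    (hf : ∀ χ, actHom k Δ χ ≫ f = f ≫ actHom k Δ (pullPoint τ χ)) (σ : Δ.cones) :
    ∃ σ' : Δ.cones, Set.range (toricInclusion k Δ σ ≫ f).left ⊆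
      Set.range (toricInclusion k Δ σ').left := by
  obtain ⟨p, hp⟩ := exists_distinguished_point (k := k) σ.1
  obtain ⟨σ', y, hy⟩ := toricInclusion_jointly_surjective k Δ
    ((toricInclusion k Δ σ ≫ f).left p)
  refine ⟨σ', ?_⟩
  -- `σ'` is any cone whose chart contains the image of the distinguished point, so the preimage `W`
  -- of that chart is open, stable and contains this point.
  let W : Set (PrimeSpectrum (coordAlg k σ.1)) :=
    (toricInclusion k Δ σ ≫ f).left ⁻¹' Set.range (toricInclusion k Δ σ').left
  have hW : IsOpen W := (toricInclusion k Δ σ').left.isOpenEmbedding.isOpen_range.preimage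
    (toricInclusion k Δ σ ≫ f).left.continuous
  have hact : ∀ (χ : torusPoints k M) (q : PrimeSpectrum (coordAlg k σ.1)),
      PrimeSpectrum.comap (actAlg k χ σ.1).toRingHom q ∈ W → q ∈ W := by
    intro χ q hq
    refine mem_range_of_actHom_mem_range (pullPoint τ χ) σ' ?_
    have h1 : (actHom k Δ (pullPoint τ χ)).left ((toricInclusion k Δ σ ≫ f).left q) =
        (specMap (actAlg k χ σ.1) ≫ toricInclusion k Δ σ ≫ f).left q := by
      have h2 : specMap (actAlg k χ σ.1) ≫ toricInclusion k Δ σ =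
        toricInclusion k Δ σ ≫ actHom k Δ χ := (toricInclusion_actHom k Δ χ σ).symm
      rw [← Category.assoc, h2, Category.assoc, hf, ← Category.assoc]
      rfl
    rw [h1]
    exact hq
  have huniv : W = Set.univ := eq_univ_of_comap_actAlg_mem hW hact ⟨y, hy⟩ hp
  rintro _ ⟨q, rfl⟩
  have : q ∈ W := huniv ▸ Set.mem_univ (q : PrimeSpectrum (coordAlg k σ.1))
  exact this

/-- If `τ` accompanies an equivariant automorphism of `X`, then `τ^*` maps every cone of the fan into a
cone of the fan. -/
lemma exists_map_transpose_le [CharZero k] [IsSeparated (toricVariety k Δ).hom] (τ : M ≃ₗ[ℤ] M)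
    (f : toricVariety k Δ ⟶ toricVariety k Δ) [IsIso f]
    (hf : ∀ χ, actHom k Δ χ ≫ f = f ≫ actHom k Δ (pullPoint τ χ)) (σ : Δ.cones) :
    ∃ σ' : Δ.cones, PointedCone.map (transpose τ) σ.1 ≤ σ'.1 := by
  obtain ⟨c, hc⟩ := exists_torus_restriction τ f hf
  obtain ⟨σ', hσ'⟩ := exists_range_subset τ f hf σ
  obtain ⟨ψ, hψ⟩ := exists_eq_specMap_comp σ' (toricInclusion k Δ σ ≫ f) hσ'
  -- Both descriptions of `f`, on the chart and on the open orbit, agree in `k[M]`.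
  have key : (toTorusAlg k σ.1).comp ψ =
      (torusTwist c τ).comp (toTorusAlg k σ'.1) := by
    apply specMap_injective
    rw [← cancel_mono (toricInclusion k Δ σ'), specMap_comp, specMap_comp, Category.assoc,
      Category.assoc, ← hψ, ← Category.assoc, specMap_toTorusAlg_comp, specMap_toTorusAlg_comp, hc]
  refine ⟨σ', fun w hw => mem_of_forall_dualMonoid (Δ.fg _ σ'.2) fun m hm => ?_⟩
  obtain ⟨v, hv, rfl⟩ := PointedCone.mem_map.1 hw
  change 0 ≤ v (τ m)
  refine (?_ : τ m ∈ dualMonoid σ.1) v hv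
  -- Otherwise `x^{τ(m)}` could not occur in an element of `k[S_σ]`, whereas it occurs in `ψ(x^m)`
  -- with the coefficient `c(m) ≠ 0`.
  by_contra hτm
  have h1 := DFunLike.congr_fun key (AddMonoidAlgebra.single ⟨m, hm⟩ 1)
  have h2 : torusTwist c τ (toTorusAlg k σ'.1 (AddMonoidAlgebra.single ⟨m, hm⟩ 1)) =
      monomial k (τ m) (c (.ofAdd m)) := by
    rw [coordMap_single]
    refine (torusTwist_monomial c τ m 1).trans ?_
    rw [one_mul]
  rw [AlgHom.comp_apply, AlgHom.comp_apply, h2] at h1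
  have h3 := toTorusAlg_coeff_of_notMem hτm (ψ (AddMonoidAlgebra.single ⟨m, hm⟩ 1))
  rw [h1, AddMonoidAlgebra.coeff_single, Finsupp.single_eq_same] at h3
  exact Units.ne_zero _ h3

end Equivariant

/-! ### Injectivity and surjectivity of the natural morphism -/

section Main

variable {k : Type u} [Field k] {M : Type u} [AddCommGroup M] {Δ : Fan M}

lemma IsFace.of_le_of_le {σ ρ σ' : PointedCone ℚ (DualQ M)} (h : IsFace σ σ') (h1 : σ ≤ ρ)
    (h2 : ρ ≤ σ') : IsFace σ ρ := by
  obtain ⟨m, hm, hσ⟩ := h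
  exact ⟨m, fun v hv => hm v (h2 hv), fun v =>
    ⟨fun hv => ⟨h1 hv, ((hσ v).1 hv).2⟩, fun hv => (hσ v).2 ⟨h2 hv.1, hv.2⟩⟩⟩

lemma map_transpose_inv (τ : M ≃ₗ[ℤ] M) (σ : PointedCone ℚ (DualQ M)) :
    PointedCone.map (transpose τ⁻¹) (PointedCone.map (transpose τ) σ) = σ := by
  rw [← transpose_mul, mul_inv_cancel, transpose_one]

lemma IsFace.of_map_transpose {σ ρ : PointedCone ℚ (DualQ M)} (τ : M ≃ₗ[ℤ] M)
    (h : IsFace σ (PointedCone.map (transpose τ⁻¹) ρ)) :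
    IsFace (PointedCone.map (transpose τ) σ) ρ := by
  obtain ⟨m, hm, hσ⟩ := h
  have hτ : ∀ v : DualQ M, v (τ⁻¹ m) = transpose τ⁻¹ v m := fun _ => rfl
  have hmem : ∀ (τ : M ≃ₗ[ℤ] M) (ρ : PointedCone ℚ (DualQ M)) (v : DualQ M),
      v ∈ PointedCone.map (transpose τ) ρ ↔ transpose τ⁻¹ v ∈ ρ := by
    intro τ ρ v
    refine ⟨fun h => ?_, fun h => ⟨_, h, LinearMap.ext fun m => congrArg v (τ.symm_apply_apply m)⟩⟩
    rw [← map_transpose_inv τ ρ]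
    exact ⟨v, h, rfl⟩
  have hinv : ∀ v, transpose τ⁻¹ v ∈ PointedCone.map (transpose τ⁻¹) ρ ↔ v ∈ ρ := fun v => by
    rw [hmem, inv_inv]
    have : transpose τ (transpose τ⁻¹ v) = v :=
      LinearMap.ext fun m => congrArg v (τ.symm_apply_apply m)
    rw [this]
  refine ⟨τ⁻¹ m, fun v hv => hm _ ((hinv v).2 hv), fun v => ?_⟩
  rw [hmem, hσ, hinv, hτ]

variable [Module.Free ℤ M] [CharZero k]

/-- The natural morphism is injective: a lattice automorphism is determined by its action on the
points of the torus. -/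
lemma naturalHom_injective : Function.Injective (naturalHom k Δ) := by
  refine (injective_iff_map_eq_one _).2 fun τ hτ => ?_
  obtain ⟨χ, hχ⟩ := (QuotientGroup.eq_one_iff _).1 hτ
  have h : (1 : Aut (torus k M)) = torusAutOfEquiv τ.unop.1 :=
    congrArg (fun p => p.1.2) hχ
  refine MulOpposite.unop_injective (Subtype.ext (LinearEquiv.ext fun m => ?_))
  by_contra hne
  obtain ⟨χ, hχ⟩ := exists_torusPoints_ne k hne
  refine hχ ?_
  have h1 := torusAutOfEquiv_points τ.unop.1 χ
  rw [← h, torusAutPoints_one] at h1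
  exact (DFunLike.congr_fun h1 (.ofAdd m)).symm

variable [IsSeparated (toricVariety k Δ).hom]

/-- The automorphism of `M` that accompanies an equivariant automorphism of `X` preserves the
fan. -/
lemma mem_autFan_of_equivariant (τ : M ≃ₗ[ℤ] M) (f : toricVariety k Δ ≅ toricVariety k Δ)
    (hf : ∀ χ, actHom k Δ χ ≫ f.hom = f.hom ≫ actHom k Δ (pullPoint τ χ)) : τ ∈ autFan Δ := by
  have hinv : ∀ χ, actHom k Δ χ ≫ f.inv = f.inv ≫ actHom k Δ (pullPoint τ⁻¹ χ) := by
    intro χ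
    have h : pullPoint τ (pullPoint τ⁻¹ χ) = χ :=
      MonoidHom.ext fun m => congrArg (fun n : M => χ (.ofAdd n)) (τ.symm_apply_apply m.toAdd)
    have := hf (pullPoint τ⁻¹ χ)
    rw [h] at this
    rw [Iso.eq_inv_comp, ← Category.assoc, ← this, Category.assoc, Iso.hom_inv_id,
      Category.comp_id]
  intro σ hσ
  obtain ⟨σ', hσ'⟩ := exists_map_transpose_le τ f.hom hf ⟨σ, hσ⟩
  obtain ⟨σ'', hσ''⟩ := exists_map_transpose_le τ⁻¹ f.inv hinv σ'
  -- The chain is `σ ⊆ (τ⁻¹)^*(σ') ⊆ σ''`. Its ends lie in the fan, so `σ` is a face of `σ''` and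
  -- therefore of the cone in the middle; applying `τ^*` makes `τ^*(σ)` a face of `σ'`.
  have h1 : σ ≤ PointedCone.map (transpose τ⁻¹) σ'.1 := by
    conv_lhs => rw [← map_transpose_inv τ σ]
    exact Submodule.map_mono hσ'
  have hface : IsFace σ σ''.1 := Δ.isFace_of_le (σ := σ'') (τ := ⟨σ, hσ⟩) (h1.trans hσ'')
  exact Δ.face_mem _ σ'.2 _ ((hface.of_le_of_le h1 hσ'').of_map_transpose τ)

/-- An automorphism of `X` accompanied by `τ` is `f_τ` up to the action of a point of the torus. -/
lemma exists_eq_act_mul_fanAut (τ : autFan Δ) (f : toricVariety k Δ ≅ toricVariety k Δ)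
    (hf : ∀ χ, actHom k Δ χ ≫ f.hom = f.hom ≫ actHom k Δ (pullPoint τ.1 χ)) :
    ∃ c : torusPoints k M, f = act k Δ c * fanAut k τ := by
  obtain ⟨c, hc⟩ := exists_torus_restriction τ.1 f.hom hf
  refine ⟨c, Iso.ext (toricVariety_hom_ext k Δ fun σ => ?_)⟩
  refine hom_ext_of_specMap (f := toTorusAlg k σ.1) (toTorusAlg_injective σ.1) ?_
  rw [← Category.assoc, specMap_toTorusAlg_comp, hc, ← Category.assoc, specMap_toTorusAlg_comp]
  change _ = toricInclusion k Δ Δ.botCone ≫ fanHom k τ ≫ actHom k Δ c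
  rw [← Category.assoc, toricInclusion_fanHom, Category.assoc, toricInclusion_actHom]
  -- `τ^*(0)` is the zero cone, but not by definition, so both sides are brought to the chart of
  -- `τ^*(0)`. There they send `x^m` to `c(m) x^{τ(m)}`.
  rw [← specMap_toTorusAlg_comp (mapCone τ Δ.botCone), ← Category.assoc, ← Category.assoc]
  refine congrArg (· ≫ toricInclusion k Δ (mapCone τ Δ.botCone)) ?_
  change _ = specMap (coordMap k _ (mem_dualMonoid_of_mapCone τ Δ.botCone)) ≫
    specMap (actAlg k c _)
  rw [← specMap_comp, ← specMap_comp]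
  congr 1
  refine AddMonoidAlgebra.algHom_ext (fun m => ?_) (Subsingleton.elim _ _)
  rw [AlgHom.comp_apply, AlgHom.comp_apply, actAlg_single, coordMap_single, coordMap_single]
  exact torusTwist_monomial c τ.1 m 1

lemma naturalHom_surjective : Function.Surjective (naturalHom k Δ) := by
  intro q
  obtain ⟨⟨⟨f, Φ⟩, hp⟩, rfl⟩ := QuotientGroup.mk_surjective q
  obtain ⟨τ, rfl⟩ := torusAutOfEquiv_surjective Φ
  have hf : ∀ χ, actHom k Δ χ ≫ f.hom = f.hom ≫ actHom k Δ (pullPoint τ χ) := by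
    intro χ
    have h : actHom k Δ χ ≫ f.hom = f.hom ≫ actHom k Δ (torusAutPoints (torusAutOfEquiv τ) χ) :=
      congrArg Iso.hom (hp χ)
    rw [h, torusAutOfEquiv_points]
  let τ' : autFan Δ := ⟨τ, mem_autFan_of_equivariant τ f hf⟩
  obtain ⟨c, hc⟩ := exists_eq_act_mul_fanAut τ' f hf
  refine ⟨.op τ', ?_⟩
  -- Normality exchanges the two cosets, so that `f = h_c ∘ f_τ` can be used in the form `f ∘ f_τ⁻¹
  -- = h_c`.
  refine QuotientGroup.eq.2 ((torusToToricAut_range_normal k Δ).mem_comm ?_)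
  refine ⟨c, Subtype.ext (Prod.ext ?_ ?_)⟩
  · exact eq_mul_inv_of_mul_eq hc.symm
  · change 1 = torusAutOfEquiv τ * (torusAutOfEquiv τ)⁻¹
    rw [mul_inv_cancel]

end Main

end Toric

end

theorem theorem7p5 {k : Type u} [Field k] [IsAlgClosed k] [CharZero k]
    {M : Type u} [AddCommGroup M] [Module.Free ℤ M] [Module.Finite ℤ M]
    (Δ : Toric.Fan M) [AlgebraicGeometry.IsProper (Toric.toricVariety k Δ).hom] :
    Function.Bijective (Toric.naturalHom k Δ) :=
  ⟨Toric.naturalHom_injective, Toric.naturalHom_surjective⟩
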